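/- **Setting.** Let $\mathbb F$ be a finite field with $q$ elements, $C$ a geometrically irreducible smooth projective curve over $\mathbb F$, $\infty$ a closed point of $C$, and $A$ the ring of functions on $C$ that are regular away from $\infty$. Let $K$ be the function field of $C$, $K_\infty$ its completion at $\infty$, and $\mathbb C_\infty$ the completion of an algebraic closure of $K_\infty$, with absolute value $|\cdot|$. Let $\ell: A\to\mathbb C_\infty$ be the inclusion and put $\deg a=\log_q|\ell(a)|$ for $a\neq 0$. Unlabelled tensor products are over $\mathbb F$. *Functions.* For $\rho>0$ let $\|f\|_\rho=\inf\max_i |c_i|\rho^{\deg a_i}$ on $A\otimes\mathbb C_\infty$, where the infimum is over all expressions $f=\sum_i a_i\otimes c_i$. Let $\mathfrak X$ be the increasing union of the affinoid spaces of the completions of $A\otimes\mathbb C_\infty$ for $\|\cdot\|_\rho$, so that $\mathcal O(\mathfrak X)$ is the completion of $A\otimes\mathbb C_\infty$ for all the norms $\|\cdot\|_\rho$ together, and let $\mathcal M(\mathfrak X)$ be its total ring of fractions. Let $\tau: f\mapsto f^{(1)}$ be the automorphism of $\mathcal O(\mathfrak X)$ and of $\mathcal M(\mathfrak X)$ extending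 $a\otimes c\mapsto a\otimes c^q$, and let $f^{(i)}=\tau^i(f)$; $\tau$ acts on the points of $\mathfrak X$ by sending a maximal ideal to its image. Let $\mathfrak j$ be the point of $\mathfrak X$ given by the kernel of $A\otimes\mathbb C_\infty\to\mathbb C_\infty$, $a\otimes c\mapsto\ell(a)c$, and let $J=\mathfrak j+\tau\mathfrak j+\tau^2\mathfrak j+\cdots$. Let $\mathcal J(\mathfrak X)\subset\mathcal M(\mathfrak X)$ be the module of meromorphic functions on $\mathfrak X$ all of whose poles lie in the support of $J$ (each pole has finite order, with no uniform bound on the orders). *Residue.* Fix a uniformizer $\pi$ of $\mathfrak X$ at $\mathfrak j$, that is, an isomorphism of the completed local ring at $\mathfrak j$ with $\mathbb C_\infty[[\pi]]$. Let $\operatorname{residue}_{\mathfrak j}:\Omega^1_{A/\mathbb F}\otimes_A\mathcal J(\mathfrak X)\to\mathbb C_\infty$ be the map sending a differential $da\otimes f$ to the coefficient of $\pi^{-1}d\pi$ in the expansion of $f\,d(a\otimes 1)$ in $\mathbb C_\infty((\pi))\,d\pi$; for $d$-tuples, it is taken componentwise. *Anderson modules.* Let $E$ be an Anderson $A$-module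 of dimension $d$ over $\mathbb C_\infty$: an $A$-module scheme over $\mathbb C_\infty$ which as an $\mathbb F$-vector space scheme is isomorphic to $\mathbb G_a^d$, and such that for all $a\in A$ the difference between the endomorphism of $\operatorname{Lie}_E(\mathbb C_\infty)$ induced by $a$ and the multiplication by $\ell(a)$ is nilpotent. A *choice of coordinates* is an isomorphism $\kappa:E\cong\mathbb G_a^d$ of $\mathbb F$-vector space schemes; it induces an isomorphism $\operatorname{Lie}_\kappa:\operatorname{Lie}_E(\mathbb C_\infty)\cong\mathbb C_\infty^d$. Let $\mathcal E_\kappa(\mathcal J)(\mathfrak X)$ be the pushout, as an $A$-module, of $$A\otimes E(\mathbb C_\infty)\xleftarrow{\ \kappa^{-1}\ }(A\otimes\mathbb C_\infty)^d\hookrightarrow\mathcal J(\mathfrak X)^d ,$$ and let $m_\kappa:\mathcal E_\kappa(\mathcal J)(\mathfrak X)\cong\mathcal J(\mathfrak X)^d$ be the inverse of the canonical map $\mathcal J(\mathfrak X)^d\to\mathcal E_\kappa(\mathcal J)(\mathfrak X)$ (an isomorphism because $\kappa^{-1}$ is one). For two choices $\kappa,\kappa'$ write $\kappa'\circ\kappa^{-1}=M_0+M_1\tau+\cdots+M_s\tau^s$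 with $M_i\in\operatorname{Mat}_d(\mathbb C_\infty)$, where $\tau$ is the $q$-Frobenius of $\mathbb G_a^d$; the transition map $\mathcal E_\kappa(\mathcal J)(\mathfrak X)\to\mathcal E_{\kappa'}(\mathcal J)(\mathfrak X)$ is the one that corresponds, under $m_\kappa$ and $m_{\kappa'}$, to $F\mapsto\sum_{i} M_iF^{(i)}$ on $\mathcal J(\mathfrak X)^d$. The $A$-module $\mathcal E(\mathcal J)(\mathfrak X)$ of *$E(\mathbb C_\infty)$-valued meromorphic functions with poles along $J$* is the inverse limit of the modules $\mathcal E_\kappa(\mathcal J)(\mathfrak X)$ over all choices of coordinates, with projections $\varepsilon_\kappa$. For each choice of coordinates $\kappa$ let $$\operatorname{res}_{\mathfrak j}^{\kappa}:\ \Omega^1_{A/\mathbb F}\otimes_A\mathcal E(\mathcal J)(\mathfrak X)\longrightarrow\operatorname{Lie}_E(\mathbb C_\infty)$$ be the unique map with $\operatorname{Lie}_\kappa\circ\operatorname{res}_{\mathfrak j}^{\kappa}=\operatorname{residue}_{\mathfrak j}\circ\bigl(\mathrm{id}\otimes(m_\kappa\circ\varepsilon_\kappa)\bigr)$. **Proposition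 4.1.** The map $\operatorname{res}_{\mathfrak j}^{\kappa}$ is independent of $\kappa$: for any two choices of coordinates $\kappa,\kappa'$ on $E$ one has $\operatorname{res}_{\mathfrak j}^{\kappa}=\operatorname{res}_{\mathfrak j}^{\kappa'}$. -/

import Mathlib

open scoped TensorProduct

universe u

namespace AndersonResidue

noncomputable section

section Rigid

variable {F A C : Type u} [Field F] [Fintype F] [CommRing A] [Algebra F A]
  [NormedField C] [Algebra F C]

/-- The degree `deg a = log_q |ℓ(a)|`. -/
def degree (ℓ : A →ₐ[F] C) (a : A) : ℝ := Real.logb (Fintype.card F) ‖ℓ a‖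

open scoped Classical in
/-- The real number `ρ ^ deg a`, with the convention `ρ ^ deg 0 = 0`. -/
def scale (ℓ : A →ₐ[F] C) (ρ : ℝ) (a : A) : ℝ := if ℓ a = 0 then 0 else ρ ^ degree ℓ a

theorem scale_nonneg (ℓ : A →ₐ[F] C) {ρ : ℝ} (hρ : 0 < ρ) (a : A) : 0 ≤ scale ℓ ρ a := by
  unfold scale; split_ifs <;> positivity

theorem scale_mul (ℓ : A →ₐ[F] C) {ρ : ℝ} (hρ : 0 < ρ) (a b : A) :
    scale ℓ ρ (a * b) = scale ℓ ρ a * scale ℓ ρ b := by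
  unfold scale degree
  rw [map_mul]
  by_cases ha : ℓ a = 0
  · simp [ha]
  by_cases hb : ℓ b = 0
  · simp [hb]
  rw [if_neg (mul_ne_zero ha hb), if_neg ha, if_neg hb, norm_mul,
    Real.logb_mul (norm_ne_zero_iff.2 ha) (norm_ne_zero_iff.2 hb), Real.rpow_add hρ]

/-- The ring `A ⊗ C` (with the factor `C` written first). It carries the topology defined by the
Gauss norms below, which depends on `ℓ`. -/
def AlgFun (_ℓ : A →ₐ[F] C) : Type u := C ⊗[F] A

variable (ℓ : A →ₐ[F] C)

instance : CommRing (AlgFun ℓ) := inferInstanceAs (CommRing (C ⊗[F] A))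
instance : Algebra C (AlgFun ℓ) := inferInstanceAs (Algebra C (C ⊗[F] A))

/-- The elementary tensor `a ⊗ c`. -/
def tens (c : C) (a : A) : AlgFun ℓ := (c ⊗ₜ[F] a : C ⊗[F] A)

/-- The elements of `A ⊗ C` which are finite sums of elementary tensors `a ⊗ c` with
`|c| ρ ^ deg a ≤ r`. -/
def gaussBall (ρ r : ℝ) : AddSubmonoid (AlgFun ℓ) :=
  AddSubmonoid.closure {t | ∃ (c : C) (a : A), t = tens ℓ c a ∧ ‖c‖ * scale ℓ ρ a ≤ r}

/-- The Gauss norm `‖f‖_ρ = inf (max_i |c_i| ρ ^ deg a_i)`, the infimum being over all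
representations of `f` as a finite sum `∑ a_i ⊗ c_i`. -/
def gaussNorm (ρ : ℝ) (f : AlgFun ℓ) : ℝ := sInf {r | 0 ≤ r ∧ f ∈ gaussBall ℓ ρ r}

theorem gaussBall_mono (ρ : ℝ) {r s : ℝ} (h : r ≤ s) : gaussBall ℓ ρ r ≤ gaussBall ℓ ρ s :=
  AddSubmonoid.closure_mono fun _ ⟨c, a, e, hr⟩ => ⟨c, a, e, hr.trans h⟩

theorem exists_mem_gaussBall (ρ : ℝ) (f : AlgFun ℓ) : ∃ r, 0 ≤ r ∧ f ∈ gaussBall ℓ ρ r := by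
  induction f using TensorProduct.induction_on with
  | zero => exact ⟨0, le_rfl, zero_mem _⟩
  | tmul c a =>
    exact ⟨max 0 (‖c‖ * scale ℓ ρ a), le_max_left _ _,
      AddSubmonoid.subset_closure ⟨c, a, rfl, le_max_right _ _⟩⟩
  | add f g hf hg =>
    obtain ⟨r, hr, hf⟩ := hf
    obtain ⟨s, hs, hg⟩ := hg
    exact ⟨max r s, hr.trans (le_max_left _ _),
      add_mem (gaussBall_mono ℓ ρ (le_max_left _ _) hf) (gaussBall_mono ℓ ρ (le_max_right _ _) hg)⟩

theorem gaussNorm_le {ρ r : ℝ} {f : AlgFun ℓ} (hr : 0 ≤ r) (hf : f ∈ gaussBall ℓ ρ r) :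
    gaussNorm ℓ ρ f ≤ r := csInf_le ⟨0, fun _ h => h.1⟩ ⟨hr, hf⟩

theorem gaussNorm_nonneg (ρ : ℝ) (f : AlgFun ℓ) : 0 ≤ gaussNorm ℓ ρ f :=
  le_csInf (exists_mem_gaussBall ℓ ρ f) fun _ h => h.1

theorem mem_gaussBall {ρ r : ℝ} {f : AlgFun ℓ} (h : gaussNorm ℓ ρ f < r) : f ∈ gaussBall ℓ ρ r := by
  obtain ⟨s, hs, hsr⟩ := exists_lt_of_csInf_lt (exists_mem_gaussBall ℓ ρ f) h
  exact gaussBall_mono ℓ ρ hsr.le hs.2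

theorem gaussBall_mul {ρ r s : ℝ} (hρ : 0 < ρ) (hr : 0 ≤ r) {f g : AlgFun ℓ}
    (hf : f ∈ gaussBall ℓ ρ r) (hg : g ∈ gaussBall ℓ ρ s) : f * g ∈ gaussBall ℓ ρ (r * s) := by
  unfold gaussBall at hf hg
  induction hf using AddSubmonoid.closure_induction with
  | mem x hx =>
    obtain ⟨c, a, rfl, h⟩ := hx
    induction hg using AddSubmonoid.closure_induction with
    | mem y hy =>
      obtain ⟨c', a', rfl, h'⟩ := hy
      refine AddSubmonoid.subset_closure ⟨c * c', a * a',
        Algebra.TensorProduct.tmul_mul_tmul c c' a a', ?_⟩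
      rw [norm_mul, scale_mul ℓ hρ, mul_mul_mul_comm]
      exact mul_le_mul h h' (mul_nonneg (norm_nonneg _) (scale_nonneg ℓ hρ _)) hr
    | zero => simp
    | add y z _ _ h h' => rw [mul_add]; exact add_mem h h'
  | zero => simp
  | add x y _ _ h h' => rw [add_mul]; exact add_mem h h'

theorem gaussBall_neg {ρ r : ℝ} {f : AlgFun ℓ} (hf : f ∈ gaussBall ℓ ρ r) :
    -f ∈ gaussBall ℓ ρ r := by
  unfold gaussBall at hf
  induction hf using AddSubmonoid.closure_induction with
  | mem x hx =>
    obtain ⟨c, a, rfl, h⟩ := hx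
    exact AddSubmonoid.subset_closure ⟨-c, a, (TensorProduct.neg_tmul c a).symm, by simpa using h⟩
  | zero => simp
  | add x y _ _ h₁ h₂ => rw [neg_add]; exact add_mem h₁ h₂

/-- The Gauss norm `‖·‖_ρ` as a ring seminorm. -/
def gaussSeminorm (ρ : Set.Ioi (0 : ℝ)) : RingSeminorm (AlgFun ℓ) where
  toFun := gaussNorm ℓ ρ
  map_zero' := le_antisymm (gaussNorm_le ℓ le_rfl (zero_mem _)) (gaussNorm_nonneg ℓ _ _)
  add_le' f g := by
    refine le_of_forall_pos_le_add fun ε hε => ?_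
    have hf : f ∈ gaussBall ℓ ρ (gaussNorm ℓ ρ f + ε) := mem_gaussBall ℓ (by linarith)
    have hg : g ∈ gaussBall ℓ ρ (gaussNorm ℓ ρ g + ε) := mem_gaussBall ℓ (by linarith)
    have h1 := gaussNorm_nonneg ℓ ρ f
    have h2 := gaussNorm_nonneg ℓ ρ g
    exact gaussNorm_le ℓ (by linarith) (add_mem (gaussBall_mono ℓ ρ (by linarith) hf)
      (gaussBall_mono ℓ ρ (by linarith) hg))
  neg' f := by
    have key : ∀ f : AlgFun ℓ, gaussNorm ℓ ρ (-f) ≤ gaussNorm ℓ ρ f := fun f =>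
      le_of_forall_gt fun r hr => by
        obtain ⟨s, hs, hsr⟩ := exists_between hr
        exact (gaussNorm_le ℓ ((gaussNorm_nonneg ℓ _ _).trans hs.le)
          (gaussBall_neg ℓ (mem_gaussBall ℓ hs))).trans_lt hsr
    exact le_antisymm (key f) (by simpa using key (-f))
  mul_le' f g := by
    refine le_mul_of_forall_lt₀ fun r hr s hs => ?_
    have h1 := (gaussNorm_nonneg ℓ ρ f).trans hr.le
    have h2 := (gaussNorm_nonneg ℓ ρ g).trans hs.le
    exact gaussNorm_le ℓ (mul_nonneg h1 h2)
      (gaussBall_mul ℓ ρ.2 h1 (mem_gaussBall ℓ hr) (mem_gaussBall ℓ hs))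

/-- The uniform structure on `A ⊗ C` defined by one Gauss norm. -/
abbrev gaussUniform (ρ : Set.Ioi (0 : ℝ)) : UniformSpace (AlgFun ℓ) :=
  (gaussSeminorm ℓ ρ).toSeminormedRing.toPseudoMetricSpace.toUniformSpace

theorem gaussUniform_isUniformAddGroup (ρ : Set.Ioi (0 : ℝ)) :
    @IsUniformAddGroup (AlgFun ℓ) (gaussUniform ℓ ρ) _ := by
  let := (gaussSeminorm ℓ ρ).toSeminormedRing
  infer_instance

theorem gaussUniform_continuousMul (ρ : Set.Ioi (0 : ℝ)) :
    @ContinuousMul (AlgFun ℓ) (gaussUniform ℓ ρ).toTopologicalSpace _ := by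
  let := (gaussSeminorm ℓ ρ).toSeminormedRing
  infer_instance

theorem gaussUniform_mem_nhds (ρ : Set.Ioi (0 : ℝ)) {r : ℝ} (hr : 0 < r) :
    {f : AlgFun ℓ | gaussNorm ℓ ρ f < r} ∈
      @nhds (AlgFun ℓ) (gaussUniform ℓ ρ).toTopologicalSpace 0 := by
  let := (gaussSeminorm ℓ ρ).toSeminormedRing
  convert! Metric.ball_mem_nhds (0 : AlgFun ℓ) hr using 1
  ext f
  rw [mem_ball_zero_iff]
  rfl

theorem gaussUniform_continuous {G : Type*} [AddGroup G] [TopologicalSpace G]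
    [IsTopologicalAddGroup G] (φ : G →+ AlgFun ℓ) (ρ : Set.Ioi (0 : ℝ))
    (h : ∀ r : ℝ, 0 < r → ∀ᶠ x in nhds (0 : G), gaussNorm ℓ ρ (φ x) < r) :
    @Continuous G (AlgFun ℓ) _ (gaussUniform ℓ ρ).toTopologicalSpace φ := by
  let := (gaussSeminorm ℓ ρ).toSeminormedRing
  refine continuous_of_continuousAt_zero φ ?_
  rw [ContinuousAt, map_zero, Metric.nhds_basis_ball.tendsto_right_iff]
  intro r hr
  filter_upwards [h r hr] with x hx
  rw [mem_ball_zero_iff]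
  exact hx

/-- The uniform structure on `A ⊗ C` defined by all the Gauss norms `‖·‖_ρ`, `ρ > 0`. -/
instance : UniformSpace (AlgFun ℓ) := ⨅ ρ : Set.Ioi (0 : ℝ), gaussUniform ℓ ρ

theorem topology_eq : (inferInstance : TopologicalSpace (AlgFun ℓ)) =
    ⨅ ρ : Set.Ioi (0 : ℝ), (gaussUniform ℓ ρ).toTopologicalSpace :=
  UniformSpace.toTopologicalSpace_iInf

instance : IsUniformAddGroup (AlgFun ℓ) :=
  isUniformAddGroup_iInf (gaussUniform_isUniformAddGroup ℓ)

instance : IsTopologicalRing (AlgFun ℓ) :=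
  { (inferInstance : IsTopologicalAddGroup (AlgFun ℓ)) with
    continuous_mul := by
      have h : @ContinuousMul (AlgFun ℓ)
          (⨅ ρ : Set.Ioi (0 : ℝ), (gaussUniform ℓ ρ).toTopologicalSpace) _ :=
        continuousMul_iInf fun ρ => gaussUniform_continuousMul ℓ ρ
      rw [← topology_eq] at h
      exact h.continuous_mul }

theorem gaussNorm_lt_mem_nhds {ρ r : ℝ} (hρ : 0 < ρ) (hr : 0 < r) :
    {f : AlgFun ℓ | gaussNorm ℓ ρ f < r} ∈ nhds (0 : AlgFun ℓ) := by
  have h := topology_eq ℓ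
  have h2 := iInf_le (fun ρ : Set.Ioi (0 : ℝ) => (gaussUniform ℓ ρ).toTopologicalSpace) ⟨ρ, hρ⟩
  rw [← h] at h2
  exact nhds_mono h2 (gaussUniform_mem_nhds ℓ ⟨ρ, hρ⟩ hr)

theorem continuous_of_gaussNorm {G : Type*} [AddGroup G] [TopologicalSpace G]
    [IsTopologicalAddGroup G] (φ : G →+ AlgFun ℓ)
    (h : ∀ ρ : ℝ, 0 < ρ → ∀ r : ℝ, 0 < r → ∀ᶠ x in nhds (0 : G), gaussNorm ℓ ρ (φ x) < r) :
    Continuous φ := by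
  have h1 : @Continuous G (AlgFun ℓ) _
      (⨅ ρ : Set.Ioi (0 : ℝ), (gaussUniform ℓ ρ).toTopologicalSpace) φ :=
    continuous_iInf_rng.2 fun ρ => gaussUniform_continuous ℓ φ ρ (h ρ ρ.2)
  rw [← topology_eq] at h1
  exact h1

/-- The ring of global sections of `𝔛`: the completion of `A ⊗ C` for all the Gauss norms, that
is, the inverse limit of the completions for the single norms `‖·‖_ρ`. -/
def Hol : Type u := UniformSpace.Completion (AlgFun ℓ)

instance : CommRing (Hol ℓ) := inferInstanceAs (CommRing (UniformSpace.Completion (AlgFun ℓ)))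
instance : UniformSpace (Hol ℓ) :=
  inferInstanceAs (UniformSpace (UniformSpace.Completion (AlgFun ℓ)))
instance : IsTopologicalRing (Hol ℓ) :=
  inferInstanceAs (IsTopologicalRing (UniformSpace.Completion (AlgFun ℓ)))

/-- The canonical map `A ⊗ C → 𝒪(𝔛)`. -/
def toHol : AlgFun ℓ →+* Hol ℓ := UniformSpace.Completion.coeRingHom

instance : Algebra C (Hol ℓ) := ((toHol ℓ).comp (algebraMap C (AlgFun ℓ))).toAlgebra

instance : Algebra A (Hol ℓ) :=
  ((toHol ℓ).comp
    (Algebra.TensorProduct.includeRight : A →ₐ[F] C ⊗[F] A).toRingHom).toAlgebra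

instance : Algebra F (Hol ℓ) := ((algebraMap C (Hol ℓ)).comp (algebraMap F C)).toAlgebra

instance : IsScalarTower F C (Hol ℓ) := IsScalarTower.of_algebraMap_eq' rfl

instance : IsScalarTower F A (Hol ℓ) := IsScalarTower.of_algebraMap_eq fun x => by
  refine congrArg (toHol ℓ) ?_
  exact (((Algebra.TensorProduct.includeRight : A →ₐ[F] C ⊗[F] A).commutes x).trans
    (IsScalarTower.algebraMap_apply F C (C ⊗[F] A) x)).symm

/-- The ring `ℳ(𝔛)` of meromorphic functions on `𝔛`: the total ring of fractions of `𝒪(𝔛)`. -/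
abbrev Mer : Type u := FractionRing (Hol ℓ)

/-! ### The Frobenius twist -/

variable [PerfectField C]


variable (F C) in
theorem frobenius_bijective : Function.Bijective (FiniteField.frobeniusAlgHom F C) := by
  obtain ⟨p, hp⟩ := CharP.exists F
  have : Fact p.Prime := ⟨CharP.char_is_prime F p⟩
  have : CharP C p := charP_of_injective_algebraMap' F p
  exact (FiniteField.frobeniusAlgEquiv F C p).bijective

variable (F C) in
/-- The `q`-Frobenius automorphism of the perfect field `C`. -/
def frob : C ≃ₐ[F] C := AlgEquiv.ofBijective _ (frobenius_bijective F C)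

/-- The automorphism `τ` of `A ⊗ C`, which is `A`-linear and is the `q`-Frobenius on `C`. -/
def twistAlg : AlgFun ℓ ≃+* AlgFun ℓ :=
  (Algebra.TensorProduct.congr (frob F C) (AlgEquiv.refl : A ≃ₐ[F] A)).toRingEquiv

theorem twistAlg_tens (c : C) (a : A) :
    twistAlg ℓ (tens ℓ c a) = tens ℓ (c ^ Fintype.card F) a := rfl

theorem twistAlg_symm_tens (c : C) (a : A) :
    (twistAlg ℓ).symm (tens ℓ c a) = tens ℓ ((frob F C).symm c) a := rfl


theorem scale_pow {ρ : ℝ} (hρ : 0 < ρ) (a : A) :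
    scale ℓ (ρ ^ Fintype.card F) a = scale ℓ ρ a ^ Fintype.card F := by
  unfold scale
  split_ifs
  · exact (zero_pow Fintype.card_ne_zero).symm
  · rw [← Real.rpow_natCast, ← Real.rpow_natCast, ← Real.rpow_mul hρ.le, ← Real.rpow_mul hρ.le,
      mul_comm]

theorem twistAlg_mem {ρ r : ℝ} (hρ : 0 < ρ) {f : AlgFun ℓ} (hf : f ∈ gaussBall ℓ ρ r) :
    twistAlg ℓ f ∈ gaussBall ℓ (ρ ^ Fintype.card F) (r ^ Fintype.card F) := by
  unfold gaussBall at hf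
  induction hf using AddSubmonoid.closure_induction with
  | mem x hx =>
    obtain ⟨c, a, rfl, h⟩ := hx
    refine AddSubmonoid.subset_closure ⟨_, a, twistAlg_tens ℓ c a, ?_⟩
    rw [scale_pow ℓ hρ, norm_pow, ← mul_pow]
    exact pow_le_pow_left₀ (mul_nonneg (norm_nonneg _) (scale_nonneg ℓ hρ _)) h _
  | zero => simp
  | add x y _ _ h h' => rw [map_add]; exact add_mem h h'

theorem twistAlg_symm_mem {ρ r : ℝ} (hρ : 0 < ρ) (hr : 0 ≤ r) {f : AlgFun ℓ}
    (hf : f ∈ gaussBall ℓ (ρ ^ Fintype.card F) (r ^ Fintype.card F)) :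
    (twistAlg ℓ).symm f ∈ gaussBall ℓ ρ r := by
  unfold gaussBall at hf
  induction hf using AddSubmonoid.closure_induction with
  | mem x hx =>
    obtain ⟨c, a, rfl, h⟩ := hx
    refine AddSubmonoid.subset_closure ⟨_, a, twistAlg_symm_tens ℓ c a, ?_⟩
    refine le_of_pow_le_pow_left₀ (n := Fintype.card F) Fintype.card_ne_zero hr ?_
    rw [mul_pow, ← scale_pow ℓ hρ, ← norm_pow]
    rwa [show (frob F C).symm c ^ Fintype.card F = c from (frob F C).apply_symm_apply c]
  | zero => simp
  | add x y _ _ h h' => rw [map_add]; exact add_mem h h'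

theorem continuous_twistAlg : Continuous (twistAlg ℓ) := by
  refine continuous_of_gaussNorm ℓ (twistAlg ℓ).toAddEquiv.toAddMonoidHom fun ρ hρ r hr => ?_
  have hq : (Fintype.card F) ≠ 0 := Fintype.card_ne_zero
  obtain ⟨s, hs, hsr⟩ := exists_between hr
  filter_upwards [gaussNorm_lt_mem_nhds ℓ (Real.rpow_pos_of_pos hρ (Fintype.card F : ℝ)⁻¹)
    (Real.rpow_pos_of_pos hs (Fintype.card F : ℝ)⁻¹)] with f hf
  have h := twistAlg_mem ℓ (Real.rpow_pos_of_pos hρ _) (mem_gaussBall ℓ hf)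
  rw [Real.rpow_inv_natCast_pow hρ.le hq, Real.rpow_inv_natCast_pow hs.le hq] at h
  exact (gaussNorm_le ℓ hs.le h).trans_lt hsr

theorem continuous_twistAlg_symm : Continuous (twistAlg ℓ).symm := by
  refine continuous_of_gaussNorm ℓ (twistAlg ℓ).symm.toAddEquiv.toAddMonoidHom
    fun ρ hρ r hr => ?_
  obtain ⟨s, hs, hsr⟩ := exists_between hr
  filter_upwards [gaussNorm_lt_mem_nhds ℓ (pow_pos hρ (Fintype.card F))
    (pow_pos hs (Fintype.card F))] with f hf
  exact (gaussNorm_le ℓ hs.le (twistAlg_symm_mem ℓ hρ hs.le (mem_gaussBall ℓ hf))).trans_lt hsr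

/-- The automorphism `τ : f ↦ f⁽¹⁾` of `𝒪(𝔛)`, extending `twistAlg` by continuity. -/
def twistHol : Hol ℓ ≃+* Hol ℓ :=
  UniformSpace.Completion.mapRingEquiv (twistAlg ℓ) (continuous_twistAlg ℓ)
    (continuous_twistAlg_symm ℓ)

theorem continuous_twistHol : Continuous (twistHol ℓ) := UniformSpace.Completion.continuous_map

theorem continuous_twistHol_symm : Continuous (twistHol ℓ).symm :=
  UniformSpace.Completion.continuous_map

theorem twistHol_toHol (f : AlgFun ℓ) : twistHol ℓ (toHol ℓ f) = toHol ℓ (twistAlg ℓ f) :=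
  UniformSpace.Completion.mapRingHom_coe (continuous_twistAlg ℓ) f

theorem twistHol_algebraMap (a : A) : twistHol ℓ (algebraMap A (Hol ℓ) a) = algebraMap A _ a := by
  refine (twistHol_toHol ℓ (tens ℓ 1 a)).trans ?_
  rw [twistAlg_tens, one_pow]
  rfl

theorem twistHol_algebraMap_const (c : C) :
    twistHol ℓ (algebraMap C (Hol ℓ) c) = algebraMap C _ (c ^ Fintype.card F) := by
  refine (twistHol_toHol ℓ (tens ℓ c 1)).trans ?_
  rw [twistAlg_tens]
  rfl

/-- The automorphism `f ↦ f⁽¹⁾` of the ring of meromorphic functions, as an `A`-linear map. -/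
def twistMer : Mer ℓ ≃ₐ[A] Mer ℓ :=
  { IsFractionRing.ringEquivOfRingEquiv (K := Mer ℓ) (L := Mer ℓ) (twistHol ℓ) with
    commutes' := fun a => by
      simp [IsScalarTower.algebraMap_apply A (Hol ℓ) (Mer ℓ), twistHol_algebraMap] }

theorem twistMer_algebraMap (g : Hol ℓ) :
    twistMer ℓ (algebraMap (Hol ℓ) (Mer ℓ) g) = algebraMap _ _ (twistHol ℓ g) := by
  simp [twistMer]

/-! ### Points of `𝔛`, poles, and the module `𝒥(𝔛)` -/

/-- A point of `𝔛`, given by the evaluation at this point: a continuous `C`-algebra homomorphism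
`𝒪(𝔛) → C`. (As `C` is algebraically closed, all points of the spaces `Sp C⟨A⟩_ρ` are of this
form, and they correspond to the maximal ideals of `A ⊗ C`.) -/
structure Point where
  /-- evaluation at the point -/
  eval : Hol ℓ →ₐ[C] C
  /-- evaluation is continuous -/
  continuous_eval : Continuous eval

variable {ℓ}

theorem Point.ext {x y : Point ℓ} (h : ∀ f, x.eval f = y.eval f) : x = y := by
  obtain ⟨x, _⟩ := x
  obtain ⟨y, _⟩ := y
  congr
  exact AlgHom.ext h

/-- The image `τ x` of a point: its ideal is the image under `τ` of the ideal of `x`. -/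
def Point.twist (x : Point ℓ) : Point ℓ where
  eval :=
    { ((frob F C : C ≃+* C).toRingHom.comp x.eval.toRingHom).comp
        (twistHol ℓ).symm.toRingHom with
      commutes' := fun c => by
        obtain ⟨c, rfl⟩ := (frob F C).surjective c
        have h : (twistHol ℓ).symm (algebraMap C (Hol ℓ) (frob F C c)) = algebraMap C _ c := by
          rw [RingEquiv.symm_apply_eq, twistHol_algebraMap_const]
          rfl
        change frob F C (x.eval ((twistHol ℓ).symm (algebraMap C (Hol ℓ) (frob F C c)))) = _
        rw [h]
        simp }
  continuous_eval := (continuous_pow (Fintype.card F)).comp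
    (x.continuous_eval.comp (continuous_twistHol_symm ℓ))

theorem Point.twist_eval (x : Point ℓ) (f : Hol ℓ) :
    x.twist.eval f = x.eval ((twistHol ℓ).symm f) ^ Fintype.card F := rfl

variable (F C) in
theorem continuous_frob_symm : Continuous (frob F C).symm := by
  have hq : Fintype.card F ≠ 0 := Fintype.card_ne_zero
  refine continuous_of_continuousAt_zero (frob F C).symm ?_
  rw [ContinuousAt, map_zero, Metric.nhds_basis_ball.tendsto_right_iff]
  intro r hr
  filter_upwards [Metric.ball_mem_nhds (0 : C) (pow_pos hr (Fintype.card F))] with c hc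
  rw [mem_ball_zero_iff] at hc ⊢
  refine lt_of_pow_lt_pow_left₀ (Fintype.card F) hr.le ?_
  rw [← norm_pow]
  rwa [show (frob F C).symm c ^ Fintype.card F = c from (frob F C).apply_symm_apply c]

/-- The inverse image of a point under `τ`. -/
def Point.untwist (x : Point ℓ) : Point ℓ where
  eval :=
    { ((frob F C).symm : C ≃+* C).toRingHom.comp
        (x.eval.toRingHom.comp (twistHol ℓ).toRingHom) with
      commutes' := fun c => by
        change (frob F C).symm (x.eval (twistHol ℓ (algebraMap C (Hol ℓ) c))) = _
        rw [twistHol_algebraMap_const, AlgHom.commutes]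
        exact (frob F C).symm_apply_apply c }
  continuous_eval := (continuous_frob_symm F C).comp
    (x.continuous_eval.comp (continuous_twistHol ℓ))

theorem Point.twist_untwist (x : Point ℓ) : x.untwist.twist = x := Point.ext fun f => by
  rw [Point.twist_eval]
  change frob F C ((frob F C).symm (x.eval (twistHol ℓ ((twistHol ℓ).symm f)))) = _
  rw [AlgEquiv.apply_symm_apply, RingEquiv.apply_symm_apply]

/-- The maximal ideal of `𝒪(𝔛)` of functions vanishing at `x`. -/
def Point.ideal (x : Point ℓ) : Ideal (Hol ℓ) := RingHom.ker x.eval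

/-- The meromorphic function `f` is regular at `x`: it is a fraction `g / h` of global functions
with `h(x) ≠ 0`. -/
def RegularAt (x : Point ℓ) (f : Mer ℓ) : Prop :=
  ∃ g h : Hol ℓ, x.eval h ≠ 0 ∧ algebraMap (Hol ℓ) (Mer ℓ) h * f = algebraMap (Hol ℓ) (Mer ℓ) g

/-- The meromorphic function `f` has a pole of order at most `n` at `x`, that is,
`ord_x f ≥ - n`: its products with the elements of `𝔪_x ^ n` are regular at `x`. -/
def PoleOrderLE (x : Point ℓ) (n : ℕ) (f : Mer ℓ) : Prop :=
  ∀ p ∈ x.ideal ^ n, RegularAt x (algebraMap (Hol ℓ) (Mer ℓ) p * f)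

theorem RegularAt.add {x : Point ℓ} {f f' : Mer ℓ} (hf : RegularAt x f) (hf' : RegularAt x f') :
    RegularAt x (f + f') := by
  obtain ⟨g, h, hx, e⟩ := hf
  obtain ⟨g', h', hx', e'⟩ := hf'
  refine ⟨h' * g + h * g', h * h', by rw [map_mul]; exact mul_ne_zero hx hx', ?_⟩
  simp only [map_mul, map_add, ← e, ← e']
  ring

theorem RegularAt.mul {x : Point ℓ} {f : Mer ℓ} (hf : RegularAt x f) (p : Hol ℓ) :
    RegularAt x (algebraMap (Hol ℓ) (Mer ℓ) p * f) := by
  obtain ⟨g, h, hx, e⟩ := hf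
  exact ⟨p * g, h, hx, by rw [map_mul, ← e]; ring⟩

theorem RegularAt.twist {x : Point ℓ} {f : Mer ℓ} (hf : RegularAt x f) :
    RegularAt x.twist (twistMer ℓ f) := by
  obtain ⟨g, h, hx, e⟩ := hf
  refine ⟨twistHol ℓ g, twistHol ℓ h, ?_, ?_⟩
  · rw [Point.twist_eval, RingEquiv.symm_apply_apply]
    exact pow_ne_zero _ hx
  · rw [← twistMer_algebraMap, ← twistMer_algebraMap, ← map_mul, e]

theorem PoleOrderLE.mono {x : Point ℓ} {f : Mer ℓ} {m n : ℕ} (h : PoleOrderLE x m f)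
    (hmn : m ≤ n) : PoleOrderLE x n f := fun p hp => h p (Ideal.pow_le_pow_right hmn hp)

theorem PoleOrderLE.add {x : Point ℓ} {f f' : Mer ℓ} {n : ℕ} (h : PoleOrderLE x n f)
    (h' : PoleOrderLE x n f') : PoleOrderLE x n (f + f') := fun p hp => by
  rw [mul_add]
  exact (h p hp).add (h' p hp)

theorem PoleOrderLE.smul {x : Point ℓ} {f : Mer ℓ} {n : ℕ} (h : PoleOrderLE x n f)
    (g : Hol ℓ) : PoleOrderLE x n (g • f) := fun p hp => by
  rw [Algebra.smul_def, mul_left_comm]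
  exact (h p hp).mul g

theorem Point.twist_ideal (x : Point ℓ) : x.twist.ideal = x.ideal.map (twistHol ℓ) := by
  ext f
  rw [Ideal.mem_map_of_equiv (twistHol ℓ)]
  constructor
  · intro h
    refine ⟨(twistHol ℓ).symm f, ?_, RingEquiv.apply_symm_apply _ _⟩
    exact pow_eq_zero_iff (Fintype.card_ne_zero (α := F)) |>.1
      ((Point.twist_eval x f).symm.trans h)
  · rintro ⟨g, hg, rfl⟩
    refine (Point.twist_eval x _).trans ?_
    rw [RingEquiv.symm_apply_apply]
    exact (pow_eq_zero_iff (Fintype.card_ne_zero (α := F))).2 hg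

theorem PoleOrderLE.twist {x : Point ℓ} {f : Mer ℓ} {n : ℕ} (h : PoleOrderLE x n f) :
    PoleOrderLE x.twist n (twistMer ℓ f) := fun p hp => by
  rw [Point.twist_ideal, ← Ideal.map_pow, Ideal.mem_map_of_equiv (twistHol ℓ)] at hp
  obtain ⟨p, hp, rfl⟩ := hp
  have := (h p hp).twist
  rwa [map_mul, twistMer_algebraMap] at this

section CharPoint

variable [IsUltrametricDist C] [CompleteSpace C]

variable (ℓ) in
/-- The multiplication map `A ⊗ C → C`, `a ⊗ c ↦ ℓ(a) c`, whose kernel is `𝔧`. -/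
def mulMap : AlgFun ℓ →+* C := (Algebra.TensorProduct.lift (AlgHom.id C C) ℓ
  (fun _ _ => Commute.all _ _) : C ⊗[F] A →ₐ[C] C).toRingHom

theorem norm_mulMap_le {r : ℝ} (hr : 0 ≤ r) {f : AlgFun ℓ}
    (hf : f ∈ gaussBall ℓ (Fintype.card F) r) : ‖mulMap ℓ f‖ ≤ r := by
  unfold gaussBall at hf
  induction hf using AddSubmonoid.closure_induction with
  | mem x hx =>
    obtain ⟨c, a, rfl, h⟩ := hx
    have e : mulMap ℓ (tens ℓ c a) = c * ℓ a := Algebra.TensorProduct.lift_tmul _ _ _ _ _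
    rw [e, norm_mul]
    convert h using 2
    unfold scale degree
    split_ifs with h0
    · rw [h0, norm_zero]
    · have h1 : (1 : ℝ) < Fintype.card F := by exact_mod_cast Fintype.one_lt_card
      exact (Real.rpow_logb (by linarith) h1.ne' (norm_pos_iff.2 h0)).symm
  | zero => simpa
  | add x y _ _ h h' =>
    rw [map_add]
    exact (IsUltrametricDist.norm_add_le_max _ _).trans (max_le h h')

variable (ℓ) in
theorem continuous_mulMap : Continuous (mulMap ℓ) := by
  refine continuous_of_continuousAt_zero (mulMap ℓ) ?_
  rw [ContinuousAt, map_zero, Metric.nhds_basis_ball.tendsto_right_iff]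
  intro r hr
  obtain ⟨s, hs, hsr⟩ := exists_between hr
  have h0 : (0 : ℝ) < Fintype.card F := by exact_mod_cast Fintype.card_pos
  filter_upwards [gaussNorm_lt_mem_nhds ℓ h0 hs] with f hf
  rw [mem_ball_zero_iff]
  exact (norm_mulMap_le hs.le (mem_gaussBall ℓ hf)).trans_lt hsr

variable (ℓ) in
/-- The point `𝔧` of `𝔛`: the extension of the multiplication map `A ⊗ C → C` by continuity. -/
def charPoint : Point ℓ where
  eval :=
    { UniformSpace.Completion.extensionHom (mulMap ℓ) (continuous_mulMap ℓ) with
      commutes' := fun c => by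
        refine (UniformSpace.Completion.extensionHom_coe _ (continuous_mulMap ℓ)
          (algebraMap C (AlgFun ℓ) c)).trans ?_
        exact (Algebra.TensorProduct.lift (AlgHom.id C C) ℓ
          (fun _ _ => Commute.all _ _) : C ⊗[F] A →ₐ[C] C).commutes c }
  continuous_eval := UniformSpace.Completion.continuous_extension

variable (ℓ) in
/-- The support `{𝔧, τ𝔧, τ²𝔧, …}` of the divisor `J`. -/
def suppJ : Set (Point ℓ) := Set.range fun i : ℕ => Point.twist^[i] (charPoint ℓ)

variable (ℓ) in
/-- The module `𝒥(𝔛)` of meromorphic functions on `𝔛` which are holomorphic away from the support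
of `J`: the poles of such a function are of finite order (without a uniform bound) and lie in the
support of `J`. -/
def merJ : Submodule (Hol ℓ) (Mer ℓ) where
  carrier := {f | ∃ n : Point ℓ → ℕ, (∀ x ∉ suppJ ℓ, n x = 0) ∧ ∀ x, PoleOrderLE x (n x) f}
  zero_mem' := ⟨fun _ => 0, fun _ _ => rfl, fun x p _ => ⟨0, 1, by simp, by simp⟩⟩
  add_mem' := by
    rintro f g ⟨n, hn, hf⟩ ⟨m, hm, hg⟩
    refine ⟨fun x => n x + m x, fun x hx => by simp [hn x hx, hm x hx], fun x => ?_⟩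
    exact ((hf x).mono (Nat.le_add_right _ _)).add ((hg x).mono (Nat.le_add_left _ _))
  smul_mem' := by
    rintro g f ⟨n, hn, hf⟩
    exact ⟨n, hn, fun x => (hf x).smul g⟩

theorem twistMer_mem {f : Mer ℓ} (hf : f ∈ merJ ℓ) : twistMer ℓ f ∈ merJ ℓ := by
  obtain ⟨n, hn, hf⟩ := hf
  refine ⟨fun x => n x.untwist, fun x hx => hn _ fun ⟨i, hi⟩ => hx ⟨i + 1, ?_⟩, fun x => ?_⟩
  · change Point.twist^[i + 1] (charPoint ℓ) = x
    rw [Function.iterate_succ_apply']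
    change Point.twist^[i] (charPoint ℓ) = _ at hi
    rw [hi, Point.twist_untwist]
  · have := (hf x.untwist).twist
    rwa [Point.twist_untwist] at this

variable (ℓ) in
/-- The twist `f ↦ f⁽¹⁾` on `𝒥(𝔛)`. -/
def twistJ : merJ ℓ →ₗ[A] merJ ℓ where
  toFun f := ⟨twistMer ℓ f, twistMer_mem f.2⟩
  map_add' f g := Subtype.ext (map_add (twistMer ℓ) _ _)
  map_smul' a f := Subtype.ext (map_smul (twistMer ℓ) a (f : Mer ℓ))

end CharPoint

/-! ### Residues -/

/-- A uniformizer at the point `x`, in the form of the resulting isomorphism of the completed local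
ring of `𝔛` at `x` with the ring `C⟦π⟧` of formal power series. -/
abbrev Uniformizer (x : Point ℓ) : Type u :=
  AdicCompletion x.ideal (Hol ℓ) ≃ₐ[C] PowerSeries C

/-- The power series expansion at `x` of a function on `𝔛`. -/
def taylor {x : Point ℓ} (e : Uniformizer x) : Hol ℓ →ₐ[C] PowerSeries C :=
  e.toAlgHom.comp (IsScalarTower.toAlgHom C (Hol ℓ) (AdicCompletion x.ideal (Hol ℓ)))

theorem taylor_ne_zero {x : Point ℓ} (e : Uniformizer x) {h : Hol ℓ} (hx : x.eval h ≠ 0) :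
    taylor e h ≠ 0 := fun h0 => hx <| by
  have h1 : algebraMap (Hol ℓ) (AdicCompletion x.ideal (Hol ℓ)) h = 0 :=
    e.injective (h0.trans (map_zero e).symm)
  have h2 := congrArg (AdicCompletion.evalₐ x.ideal 1) h1
  rw [map_zero, AlgHom.commutes] at h2
  have h3 := Ideal.Quotient.eq_zero_iff_mem.1 h2
  rwa [pow_one] at h3

theorem exists_taylor_ne_zero {x : Point ℓ} (e : Uniformizer x) :
    ∃ y ∈ x.ideal, taylor e y ≠ 0 := by
  by_contra! H
  have key : ∀ g : Hol ℓ, algebraMap (Hol ℓ) (AdicCompletion x.ideal (Hol ℓ)) g =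
      algebraMap C _ (x.eval g) := fun g => by
    have h1 : g - algebraMap C (Hol ℓ) (x.eval g) ∈ x.ideal := by
      simp [Point.ideal, RingHom.mem_ker]
    have h2 := e.injective ((H _ h1).trans (map_zero e).symm)
    have h3 : algebraMap (Hol ℓ) (AdicCompletion x.ideal (Hol ℓ))
      (g - algebraMap C (Hol ℓ) (x.eval g)) = 0 := h2
    rw [map_sub, sub_eq_zero] at h3
    rw [h3, ← IsScalarTower.algebraMap_apply]
  have hI : ∀ (n : ℕ) (y : Hol ℓ), y ∈ x.ideal → y ∈ x.ideal ^ n := fun n y hy => by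
    have h1 := congrArg (AdicCompletion.evalₐ x.ideal n) (key y)
    rw [show x.eval y = 0 from hy, map_zero, map_zero, AlgHom.commutes] at h1
    exact Ideal.Quotient.eq_zero_iff_mem.1 h1
  obtain ⟨a, ha⟩ := AdicCompletion.mk_surjective x.ideal (Hol ℓ) (e.symm PowerSeries.X)
  set g : ℕ → Hol ℓ := a.val with hgdef
  have hg : ∀ n, Ideal.Quotient.mk (x.ideal ^ n) (g n) =
      AdicCompletion.evalₐ x.ideal n (e.symm PowerSeries.X) := fun n => by
    rw [← ha, AdicCompletion.evalₐ_mk]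
  have hgn : ∀ n, g n - g 1 ∈ x.ideal ^ n := fun n => by
    rcases Nat.eq_zero_or_pos n with rfl | hn
    · simp
    refine hI n _ ?_
    have h1 := (SModEq.sub_mem.1 (a.property (m := 1) (n := n) hn).symm)
    simpa using h1
  have h1 : e.symm PowerSeries.X = algebraMap C _ (x.eval (g 1)) := by
    rw [← key]
    refine AdicCompletion.ext_evalₐ fun n => ?_
    rw [← hg n, AlgHom.commutes]
    exact Ideal.Quotient.eq.2 (hgn n)
  rw [AlgEquiv.symm_apply_eq, AlgEquiv.commutes] at h1
  have h2 := congrArg (PowerSeries.coeff 1) h1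
  simp [PowerSeries.algebraMap_apply, PowerSeries.coeff_C] at h2

/-- The field of Laurent series in the uniformizer, seen as an `A`-algebra by means of the
expansion of the elements of `A`. -/
def Laurent {x : Point ℓ} (_e : Uniformizer x) : Type u := LaurentSeries C

instance {x : Point ℓ} (e : Uniformizer x) : Field (Laurent e) :=
  inferInstanceAs (Field (LaurentSeries C))

/-- The inclusion of the power series into the Laurent series. -/
def ofSeries {x : Point ℓ} (e : Uniformizer x) : PowerSeries C →+* Laurent e :=
  HahnSeries.ofPowerSeries ℤ C

/-- The Laurent expansion of a function on `𝔛`. -/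
def toLaurent {x : Point ℓ} (e : Uniformizer x) : Hol ℓ →+* Laurent e :=
  (ofSeries e).comp (taylor e).toRingHom

instance {x : Point ℓ} (e : Uniformizer x) : Algebra A (Laurent e) :=
  ((toLaurent e).comp (algebraMap A (Hol ℓ))).toAlgebra

instance {x : Point ℓ} (e : Uniformizer x) : Algebra F (Laurent e) :=
  ((algebraMap A (Laurent e)).comp (algebraMap F A)).toAlgebra

instance {x : Point ℓ} (e : Uniformizer x) : IsScalarTower F A (Laurent e) :=
  IsScalarTower.of_algebraMap_eq' rfl

theorem toLaurent_ne_zero {x : Point ℓ} (e : Uniformizer x) {h : Hol ℓ} (hx : taylor e h ≠ 0) :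
    toLaurent e h ≠ 0 := fun h0 =>
  hx (HahnSeries.ofPowerSeries_injective (h0.trans (map_zero (ofSeries e)).symm))

open scoped Classical in
/-- The Laurent expansion at `x` of a meromorphic function on `𝔛` (with the value `0` if the
function is not a fraction with a denominator of finite order at `x`). -/
def expand {x : Point ℓ} (e : Uniformizer x) (f : Mer ℓ) : Laurent e :=
  if H : ∃ g h : Hol ℓ, taylor e h ≠ 0 ∧
      algebraMap (Hol ℓ) (Mer ℓ) h * f = algebraMap (Hol ℓ) (Mer ℓ) g then
    toLaurent e H.choose / toLaurent e H.choose_spec.choose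
  else 0

theorem expand_eq {x : Point ℓ} (e : Uniformizer x) {f : Mer ℓ} {g h : Hol ℓ}
    (h0 : taylor e h ≠ 0)
    (hf : algebraMap (Hol ℓ) (Mer ℓ) h * f = algebraMap (Hol ℓ) (Mer ℓ) g) :
    expand e f = toLaurent e g / toLaurent e h := by
  have H : ∃ g h : Hol ℓ, taylor e h ≠ 0 ∧
      algebraMap (Hol ℓ) (Mer ℓ) h * f = algebraMap (Hol ℓ) (Mer ℓ) g := ⟨g, h, h0, hf⟩
  rw [expand, dif_pos H]
  obtain ⟨h1, h2⟩ := H.choose_spec.choose_spec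
  rw [div_eq_div_iff (toLaurent_ne_zero e h1) (toLaurent_ne_zero e h0), ← map_mul, ← map_mul]
  congr 1
  apply IsFractionRing.injective (Hol ℓ) (Mer ℓ)
  rw [map_mul, map_mul, ← hf]
  linear_combination (-algebraMap (Hol ℓ) (Mer ℓ) h) * h2

section CharPoint2

variable [IsUltrametricDist C] [CompleteSpace C]

theorem exists_fraction {x : Point ℓ} (e : Uniformizer x) {f : Mer ℓ} (hf : f ∈ merJ ℓ) :
    ∃ g h : Hol ℓ, taylor e h ≠ 0 ∧
      algebraMap (Hol ℓ) (Mer ℓ) h * f = algebraMap (Hol ℓ) (Mer ℓ) g := by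
  obtain ⟨n, -, hn⟩ := hf
  obtain ⟨y, hy, hy0⟩ := exists_taylor_ne_zero e
  obtain ⟨g, h, hx, E⟩ := hn x (y ^ n x) (Ideal.pow_mem_pow hy _)
  refine ⟨g, h * y ^ n x, ?_, by rw [map_mul, mul_assoc, E]⟩
  rw [map_mul, map_pow]
  exact mul_ne_zero (taylor_ne_zero e hx) (pow_ne_zero _ hy0)

/-- The Laurent expansion at `x` of the elements of `𝒥(𝔛)`. -/
def expandJ {x : Point ℓ} (e : Uniformizer x) : merJ ℓ →ₗ[A] Laurent e where
  toFun f := expand e f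
  map_add' f f' := by
    obtain ⟨g, h, h0, E⟩ := exists_fraction e f.2
    obtain ⟨g', h', h0', E'⟩ := exists_fraction e f'.2
    rw [expand_eq e h0 E, expand_eq e h0' E', expand_eq e (g := g * h' + h * g') (h := h * h')
      (by rw [map_mul]; exact mul_ne_zero h0 h0') (by
        rw [map_add, map_mul, map_mul, map_mul, ← E, ← E', Submodule.coe_add]; ring),
      div_add_div _ _ (toLaurent_ne_zero e h0) (toLaurent_ne_zero e h0')]
    simp only [map_add, map_mul]
  map_smul' a f := by
    obtain ⟨g, h, h0, E⟩ := exists_fraction e f.2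
    rw [expand_eq e h0 E, expand_eq e (g := algebraMap A (Hol ℓ) a * g) h0 (by
      rw [map_mul, ← E, show ((a • f : merJ ℓ) : Mer ℓ) = a • (f : Mer ℓ) from rfl, Algebra.smul_def,
        IsScalarTower.algebraMap_apply A (Hol ℓ) (Mer ℓ)]; ring), Algebra.smul_def, mul_div_assoc']
    rw [map_mul]
    rfl

/-- The derivation `a ↦ da / dπ` of `A`. -/
def localDer {x : Point ℓ} (e : Uniformizer x) : Derivation F A (Laurent e) :=
  Derivation.mk'
    { toFun := fun a => ofSeries e
        (PowerSeries.derivative (R := C) (taylor e (algebraMap A (Hol ℓ) a)))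
      map_add' := fun a b => by simp only [map_add]
      map_smul' := fun c a => by
        have h : algebraMap A (Hol ℓ) (c • a) =
            algebraMap F C c • algebraMap A (Hol ℓ) a := by
          rw [Algebra.smul_def, map_mul, Algebra.smul_def,
            ← IsScalarTower.algebraMap_apply, ← IsScalarTower.algebraMap_apply]
        have h' : algebraMap F (Laurent e) c = ofSeries e
            (algebraMap C (PowerSeries C) (algebraMap F C c)) := by
          change ofSeries e (taylor e (algebraMap A (Hol ℓ)
            (algebraMap F A c))) = _
          rw [← IsScalarTower.algebraMap_apply, IsScalarTower.algebraMap_apply F C (Hol ℓ),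
            AlgHom.commutes]
        rw [h, map_smul, Derivation.map_smul, Algebra.smul_def, map_mul, RingHom.id_apply, ← h']
        exact (Algebra.smul_def (A := Laurent e) c _).symm }
    fun a b => by
      change ofSeries e
        (PowerSeries.derivative (R := C) (taylor e (algebraMap A (Hol ℓ) (a * b)))) = _
      rw [map_mul, map_mul, Derivation.leibniz, map_add, smul_eq_mul, smul_eq_mul, map_mul,
        map_mul, Algebra.smul_def, Algebra.smul_def]
      rfl

/-- The expansion `ω ⊗ f ↦ f(π) ω / dπ` of the meromorphic differentials. -/
def expandForm {x : Point ℓ} (e : Uniformizer x) : Ω[A⁄F] ⊗[A] merJ ℓ →ₗ[A] Laurent e :=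
  TensorProduct.lift ((LinearMap.mul A (Laurent e)).compl₁₂
    (localDer e).liftKaehlerDifferential (expandJ e))

/-- The residue at `x`: the coefficient of `π⁻¹ dπ`. -/
def residue {x : Point ℓ} (e : Uniformizer x) : Ω[A⁄F] ⊗[A] merJ ℓ →+ C :=
  (HahnSeries.coeff.addMonoidHom (-1 : ℤ) : LaurentSeries C →+ C).comp (expandForm e).toAddMonoidHom

/-- The residue at `x`, for `d`-tuples of functions. -/
def residueVec {x : Point ℓ} (e : Uniformizer x) (d : ℕ) :
    Ω[A⁄F] ⊗[A] (Fin d → merJ ℓ) →+ (Fin d → C) :=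
  AddMonoidHom.pi fun k => (residue e).comp
    (LinearMap.lTensor Ω[A⁄F] (LinearMap.proj k : (Fin d → merJ ℓ) →ₗ[A] merJ ℓ)).toAddMonoidHom

end CharPoint2

/-! ### Anderson modules -/

open CategoryTheory

variable (F C) in
/-- The `F`-vector space scheme `𝔾_a ^ d` over `C`, as a functor on `C`-algebras. -/
def GaPow (d : ℕ) : CommAlgCat.{u} C ⥤ ModuleCat.{u} F where
  obj R := (ModuleCat.restrictScalars (algebraMap F C)).obj (ModuleCat.of C (Fin d → R))
  map f := (ModuleCat.restrictScalars (algebraMap F C)).map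
    (ModuleCat.ofHom (f.hom.toLinearMap.compLeft (Fin d)))

/-- The `F`-vector space scheme underlying an `A`-module scheme. -/
abbrev underlying (F : Type u) {A C : Type u} [Field F] [CommRing A] [Algebra F A]
    [CommRing C] (E : CommAlgCat.{u} C ⥤ ModuleCat.{u} A) :
    CommAlgCat.{u} C ⥤ ModuleCat.{u} F :=
  E ⋙ ModuleCat.restrictScalars (algebraMap F A)

/-- The algebra of dual numbers `C[ε]`. -/
abbrev dual (C : Type u) [CommRing C] : CommAlgCat.{u} C := CommAlgCat.of C (DualNumber C)

/-- The homomorphism `ε ↦ 0`. -/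
abbrev dualFst (C : Type u) [CommRing C] : dual C ⟶ CommAlgCat.of C C :=
  CommAlgCat.ofHom (TrivSqZeroExt.fstHom C C C)

/-- The homomorphism `ε ↦ c ε`. -/
abbrev dualScale {C : Type u} [CommRing C] (c : C) : dual C ⟶ dual C :=
  CommAlgCat.ofHom (TrivSqZeroExt.map (c • LinearMap.id))

/-- The tangent space `Lie_E(C) = ker (E(C[ε]) → E(C))`, with its `A`-module structure. -/
def Lie (E : CommAlgCat.{u} C ⥤ ModuleCat.{u} A) : Submodule A (E.obj (dual C)) :=
  LinearMap.ker (E.map (dualFst C)).hom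

/-- The multiplication by `c ∈ C` on `Lie_E(C)`, induced by `ε ↦ c ε`. -/
def Lie.scale (E : CommAlgCat.{u} C ⥤ ModuleCat.{u} A) (c : C) : Module.End A (Lie E) :=
  (E.map (dualScale c)).hom.restrict fun v hv => by
    have h : dualScale c ≫ dualFst C = dualFst C := by
      ext x
      simp
    change (E.map (dualFst C)).hom ((E.map (dualScale c)).hom v) = 0
    rw [← LinearMap.comp_apply, ← ModuleCat.hom_comp, ← E.map_comp, h]
    exact hv

/-- The choices of coordinates on an `A`-module scheme `E`: the isomorphisms of `E` with
`𝔾_a ^ d` as `F`-vector space schemes. -/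
abbrev Coordinates (F : Type u) {A C : Type u} [Field F] [CommRing A] [Algebra F A]
    [NormedField C] [Algebra F C] (E : CommAlgCat.{u} C ⥤ ModuleCat.{u} A) (d : ℕ) : Type _ :=
  underlying F E ≅ GaPow F C d

variable (ℓ) in
/-- Anderson `A`-modules of dimension `d` over `C`, with characteristic morphism `ℓ`. -/
structure AndersonModule (d : ℕ) where
  /-- the functor of points of the `A`-module scheme -/
  functor : CommAlgCat.{u} C ⥤ ModuleCat.{u} A
  /-- as an `F`-vector space scheme, it is isomorphic to `𝔾_a ^ d` -/
  exists_coordinates : Nonempty (Coordinates F functor d)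
  /-- `∂φ(a) - ℓ(a)` is nilpotent on the tangent space -/
  isNilpotent : ∀ a : A,
    IsNilpotent (algebraMap A (Module.End A (Lie functor)) a - Lie.scale functor (ℓ a))

section Coord

variable {E : CommAlgCat.{u} C ⥤ ModuleCat.{u} A} {d : ℕ}

/-- The bijection `E(R) ≅ R ^ d` given by the coordinates. -/
def Coordinates.equiv (κ : Coordinates F E d) (R : CommAlgCat.{u} C) :
    ((underlying F E).obj R) ≃ₗ[F] ((GaPow F C d).obj R) :=
  (κ.app R).toLinearEquiv

theorem Coordinates.equiv_map (κ : Coordinates F E d) {R S : CommAlgCat.{u} C} (f : R ⟶ S)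
    (v : E.obj R) (k : Fin d) :
    (κ.equiv S ((E.map f).hom v) : Fin d → S) k = f.hom ((κ.equiv R v : Fin d → R) k) := by
  have h := κ.hom.naturality f
  have h2 := congrArg (fun g => (g.hom v : Fin d → S) k) h
  exact h2

/-- The isomorphism `Lie_κ : Lie_E(C) ≅ C ^ d` induced by the coordinates `κ` on the kernels of
`ε ↦ 0`; the kernel of `C[ε] ^ d → C ^ d` is `ε C ^ d`, identified with `C ^ d`. -/
def Coordinates.lie (κ : Coordinates F E d) : Lie E ≃+ (Fin d → C) where
  toFun v k := TrivSqZeroExt.snd ((κ.equiv (dual C) (v : E.obj (dual C)) : Fin d → DualNumber C) k)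
  invFun w := ⟨(κ.equiv (dual C)).symm (fun k => TrivSqZeroExt.inr (w k) : Fin d → DualNumber C), by
    refine LinearMap.mem_ker.2 ((κ.equiv (CommAlgCat.of C C)).injective ?_)
    refine Eq.trans ?_ (map_zero (κ.equiv (CommAlgCat.of C C))).symm
    funext k
    refine (κ.equiv_map (dualFst C) _ k).trans ?_
    refine (congrArg (fun g : Fin d → DualNumber C => TrivSqZeroExt.fst (g k))
      ((κ.equiv (dual C)).apply_symm_apply _)).trans ?_
    exact TrivSqZeroExt.fst_inr _ _⟩
  left_inv v := by
    refine Subtype.ext ((κ.equiv (dual C)).symm_apply_eq.2 ?_)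
    funext k
    have h := κ.equiv_map (dualFst C) (v : E.obj (dual C)) k
    rw [show (E.map (dualFst C)).hom (v : E.obj (dual C)) = 0 from v.2] at h
    refine TrivSqZeroExt.ext ?_ rfl
    refine Eq.trans ?_ h
    exact (congrArg (fun g : Fin d → C => g k) (map_zero (κ.equiv (CommAlgCat.of C C)))).symm
  right_inv w := by
    funext k
    change TrivSqZeroExt.snd ((κ.equiv (dual C) ((κ.equiv (dual C)).symm
      (fun k => TrivSqZeroExt.inr (w k) : Fin d → DualNumber C)) : Fin d → DualNumber C) k) = _
    refine (congrArg (fun g : Fin d → DualNumber C => TrivSqZeroExt.snd (g k))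
      ((κ.equiv (dual C)).apply_symm_apply _)).trans ?_
    exact TrivSqZeroExt.snd_inr _ _
  map_add' v w := by
    funext k
    exact congrArg (fun g : Fin d → DualNumber C => TrivSqZeroExt.snd (g k))
      (map_add (κ.equiv (dual C)) _ _)

/-- The algebra `C[X_1, …, X_d]`. -/
abbrev polyAlg (C : Type u) [CommRing C] (d : ℕ) : CommAlgCat.{u} C :=
  CommAlgCat.of C (MvPolynomial (Fin d) C)

/-- The polynomials in `d` variables which describe the automorphism `κ' ∘ κ⁻¹` of `𝔾_a ^ d`: the
image of the generic point `(X_1, …, X_d)`. -/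
def Coordinates.transPoly (κ κ' : Coordinates F E d) : Fin d → MvPolynomial (Fin d) C :=
  κ'.equiv (polyAlg C d) ((κ.equiv (polyAlg C d)).symm
    (fun l => MvPolynomial.X l : Fin d → MvPolynomial (Fin d) C))

/-- The matrix `M_i` in the expansion `κ' ∘ κ⁻¹ = M_0 + M_1 τ + … + M_s τ ^ s`: its entries are the
coefficients of the monomials `X_l ^ (q ^ i)`. -/
def Coordinates.transMatrix (κ κ' : Coordinates F E d) (i : ℕ) : Matrix (Fin d) (Fin d) C :=
  Matrix.of fun k l => (κ.transPoly κ' k).coeff (Finsupp.single l (Fintype.card F ^ i))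

/-- A bound for the degree in `τ` of `κ' ∘ κ⁻¹`; the matrices `M_i` vanish for larger `i`. -/
def Coordinates.transDegree (κ κ' : Coordinates F E d) : ℕ :=
  Finset.univ.sup fun k => (κ.transPoly κ' k).totalDegree

section Functions

variable [IsUltrametricDist C] [CompleteSpace C]

instance : SMulCommClass A C (merJ ℓ) where
  smul_comm a c f := Subtype.ext <| by
    change a • c • (f : Mer ℓ) = c • a • (f : Mer ℓ)
    simp only [Algebra.smul_def]
    ring

variable (ℓ)

/-- The action of `κ' ∘ κ⁻¹ = M_0 + M_1 τ + … + M_s τ ^ s` on `𝒥(𝔛) ^ d`, that is,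
`G ↦ M_0 G + M_1 G⁽¹⁾ + … + M_s G⁽ˢ⁾`. -/
def Coordinates.trans (κ κ' : Coordinates F E d) :
    (Fin d → merJ ℓ) →ₗ[A] (Fin d → merJ ℓ) where
  toFun G k := ∑ i ∈ Finset.range (κ.transDegree κ' + 1), ∑ l,
    κ.transMatrix κ' i k l • (twistJ ℓ ^ i) (G l)
  map_add' G H := by
    funext k
    simp only [Pi.add_apply, map_add, smul_add, Finset.sum_add_distrib]
  map_smul' a G := by
    funext k
    simp only [Pi.smul_apply, map_smul, RingHom.id_apply, Finset.smul_sum, smul_comm a]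

/-- The inclusion of the constant function `1` into `𝒥(𝔛)`. -/
def oneJ : merJ ℓ := ⟨1, fun _ => 0, fun _ _ => rfl, fun _ p _ => ⟨p, 1, by simp, by simp⟩⟩

/-- The inclusion `(A ⊗ C) ^ d → 𝒥(𝔛) ^ d`, with `(A ⊗ C) ^ d` written as `A ⊗ C ^ d`. -/
def inclJ (d : ℕ) :
    A ⊗[F] ((GaPow F C d).obj (CommAlgCat.of C C)) →ₗ[A] (Fin d → merJ ℓ) :=
  LinearMap.liftBaseChange A
    { toFun := fun v : Fin d → C => fun k => v k • oneJ ℓ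
      map_add' := fun v w => funext fun k => add_smul (v k) (w k) _
      map_smul' := fun c v => funext fun k => by
        change (algebraMap F C c * v k) • oneJ ℓ = c • v k • oneJ ℓ
        rw [mul_smul, algebraMap_smul] }

variable {ℓ}

/-- The map `A ⊗ E(C) ≅ (A ⊗ C) ^ d` given by the coordinates. -/
def Coordinates.points (κ : Coordinates F E d) :
    A ⊗[F] ((underlying F E).obj (CommAlgCat.of C C)) ≃ₗ[A]
      A ⊗[F] ((GaPow F C d).obj (CommAlgCat.of C C)) :=
  (κ.equiv (CommAlgCat.of C C)).baseChange F A _ _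

variable (ℓ) in
/-- The submodule by which one divides to obtain the pushout of
`A ⊗ E(C) ← (A ⊗ C) ^ d → 𝒥(𝔛) ^ d`. -/
def Coordinates.relations (κ : Coordinates F E d) :
    Submodule A ((A ⊗[F] ((underlying F E).obj (CommAlgCat.of C C))) × (Fin d → merJ ℓ)) :=
  LinearMap.range (LinearMap.prod κ.points.symm.toLinearMap (-inclJ ℓ d))

variable (ℓ) in
/-- The `A`-module `ℰ_κ(𝒥)(𝔛)`: the pushout of `A ⊗ E(C) ← (A ⊗ C) ^ d → 𝒥(𝔛) ^ d`. -/
abbrev Coordinates.functions (κ : Coordinates F E d) : Type u :=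
  ((A ⊗[F] ((underlying F E).obj (CommAlgCat.of C C))) × (Fin d → merJ ℓ)) ⧸ κ.relations ℓ

variable (ℓ) in
/-- The lower horizontal map `𝒥(𝔛) ^ d → ℰ_κ(𝒥)(𝔛)` of the pushout square. -/
def Coordinates.lower (κ : Coordinates F E d) : (Fin d → merJ ℓ) →ₗ[A] κ.functions ℓ :=
  (κ.relations ℓ).mkQ ∘ₗ LinearMap.inr A _ _

variable (ℓ) in
/-- The map `m_κ : ℰ_κ(𝒥)(𝔛) → 𝒥(𝔛) ^ d`, inverse to the lower horizontal map. -/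
def Coordinates.m (κ : Coordinates F E d) : κ.functions ℓ →ₗ[A] (Fin d → merJ ℓ) :=
  (κ.relations ℓ).liftQ
    (LinearMap.coprod (inclJ ℓ d ∘ₗ κ.points.toLinearMap) LinearMap.id) <| by
      rintro _ ⟨v, rfl⟩
      simp

theorem Coordinates.m_lower (κ : Coordinates F E d) (G : Fin d → merJ ℓ) :
    κ.m ℓ (κ.lower ℓ G) = G := by
  simp [Coordinates.m, Coordinates.lower]

theorem Coordinates.lower_m (κ : Coordinates F E d) (s : κ.functions ℓ) :
    κ.lower ℓ (κ.m ℓ s) = s := by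
  obtain ⟨⟨y, G⟩, rfl⟩ := (κ.relations ℓ).mkQ_surjective s
  refine (Submodule.Quotient.eq _).2 ⟨-κ.points y, ?_⟩
  ext
  · simp
  · simp [Coordinates.m]

variable (ℓ) in
/-- The transition map `t_{κ,κ'} : ℰ_κ(𝒥)(𝔛) → ℰ_{κ'}(𝒥)(𝔛)`, which is the action of `κ' ∘ κ⁻¹` on
`𝒥(𝔛) ^ d` when both sides are identified with `𝒥(𝔛) ^ d`. -/
def Coordinates.transition (κ κ' : Coordinates F E d) : κ.functions ℓ →ₗ[A] κ'.functions ℓ :=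
  κ'.lower ℓ ∘ₗ κ.trans ℓ κ' ∘ₗ κ.m ℓ

variable (ℓ E d) in
/-- The `A`-module `ℰ(𝒥)(𝔛)` of `E(C)`-valued meromorphic functions with poles along `J`: the
inverse limit of the `ℰ_κ(𝒥)(𝔛)` over all choices of coordinates `κ`. -/
def valuedFunctions : Submodule A (∀ κ : Coordinates F E d, κ.functions ℓ) where
  carrier := {s | ∀ κ κ' : Coordinates F E d, κ.transition ℓ κ' (s κ) = s κ'}
  zero_mem' := fun κ κ' => by simp
  add_mem' := fun {s t} hs ht κ κ' => by
    simp only [Pi.add_apply, map_add, hs κ κ', ht κ κ']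
  smul_mem' := fun a s hs κ κ' => by simp only [Pi.smul_apply, map_smul, hs κ κ']

variable (ℓ) in
/-- The projection `ε_κ : ℰ(𝒥)(𝔛) → ℰ_κ(𝒥)(𝔛)`. -/
def Coordinates.proj (κ : Coordinates F E d) : valuedFunctions ℓ E d →ₗ[A] κ.functions ℓ :=
  LinearMap.proj κ ∘ₗ (valuedFunctions ℓ E d).subtype

/-- The map `res_𝔧 : Ω_{A/F} ⊗ ℰ(𝒥)(𝔛) → Lie_E(C)` defined by means of the coordinates `κ`: the
unique map with `Lie_κ ∘ res_𝔧 = residue_𝔧 ∘ (id ⊗ (m_κ ∘ ε_κ))`. -/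
def Coordinates.res (κ : Coordinates F E d) (e : Uniformizer (charPoint ℓ)) :
    Ω[A⁄F] ⊗[A] valuedFunctions ℓ E d →+ Lie E :=
  κ.lie.symm.toAddMonoidHom.comp ((residueVec e d).comp
    (LinearMap.lTensor Ω[A⁄F] (κ.m ℓ ∘ₗ κ.proj ℓ)).toAddMonoidHom)

theorem Coordinates.lie_res (κ : Coordinates F E d) (e : Uniformizer (charPoint ℓ))
    (ω : Ω[A⁄F] ⊗[A] valuedFunctions ℓ E d) :
    κ.lie (κ.res e ω) = residueVec e d (LinearMap.lTensor Ω[A⁄F] (κ.m ℓ ∘ₗ κ.proj ℓ) ω) :=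
  κ.lie.apply_symm_apply _

end Functions

end Coord

end Rigid

/-! ### The curve and the field `ℂ_∞` -/

section Curve

open CategoryTheory AlgebraicGeometry IsDedekindDomain

/-- A geometrically irreducible smooth projective curve over `F`, together with a closed point `∞`.
The curve is given as an integral proper scheme whose local rings at the closed points are
discrete valuation rings; over a perfect field (here `F` will be finite) this is the same as a
smooth projective curve. -/
structure PointedCurve (F : Type u) [Field F] where
  /-- the curve -/
  scheme : Scheme.{u}
  /-- the structure morphism -/
  hom : scheme ⟶ Spec (CommRingCat.of F)
  isIntegral : IsIntegral scheme
  isProper : IsProper hom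
  geometricallyIrreducible : GeometricallyIrreducible hom
  isDiscreteValuationRing : ∀ x : scheme, IsClosed {x} →
    IsDiscreteValuationRing (scheme.presheaf.stalk x)
  /-- the closed point `∞` -/
  infty : scheme
  isClosed_infty : IsClosed {infty}

namespace PointedCurve

variable {F : Type u} [Field F] (X : PointedCurve F)

instance : IsIntegral X.scheme := X.isIntegral

/-- The complement of the point `∞`. -/
def affinePart : X.scheme.Opens := ⟨{X.infty}ᶜ, X.isClosed_infty.isOpen_compl⟩

/-- The local ring at `∞`. -/
abbrev localRing : Type u := X.scheme.presheaf.stalk X.infty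

instance : IsDiscreteValuationRing X.localRing := X.isDiscreteValuationRing _ X.isClosed_infty

theorem genericPoint_ne : genericPoint X.scheme ≠ X.infty := fun h => by
  have h1 : ∀ y, genericPoint X.scheme = y → IsField (X.scheme.presheaf.stalk y) := by
    rintro _ rfl
    exact Field.toIsField X.scheme.functionField
  exact IsDiscreteValuationRing.not_isField X.localRing (h1 _ h)

instance : Nonempty X.affinePart := ⟨⟨genericPoint X.scheme, X.genericPoint_ne⟩⟩

/-- The ring `A` of functions which are regular away from `∞`. -/
def A : Type u := Γ(X.scheme, X.affinePart)

instance : CommRing X.A := inferInstanceAs (CommRing Γ(X.scheme, X.affinePart))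

/-- The structure of `F`-algebra on `A`. -/
def structureMap : F →+* X.A :=
  (((Scheme.ΓSpecIso (CommRingCat.of F)).inv ≫ X.hom.appTop) ≫
    X.scheme.presheaf.map (homOfLE le_top : X.affinePart ⟶ ⊤).op).hom

instance : Algebra F X.A := X.structureMap.toAlgebra

/-- The function field `K` of the curve. -/
abbrev K : Type u := X.scheme.functionField

/-- The place `∞` of `K`. -/
abbrev place : HeightOneSpectrum X.localRing := IsDiscreteValuationRing.maximalIdeal X.localRing

/-- The completion `K_∞` of `K` at `∞`. -/
abbrev KInf : Type u := X.place.adicCompletion X.K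

variable [Fintype F]

/-- The absolute value `|x| = q ^ (- ord_∞ x)` on `K_∞`, where `q` is the number of elements
of `F`. -/
abbrev rankOne : (Valued.v : Valuation X.KInf (WithZero (Multiplicative ℤ))).RankOne :=
  Valuation.IsRankOneDiscrete.rankOne (Valued.v : Valuation X.KInf (WithZero (Multiplicative ℤ)))
    (e := (Fintype.card F : NNReal)) (by exact_mod_cast Fintype.one_lt_card)

instance : NontriviallyNormedField X.KInf :=
  letI := X.rankOne
  Valued.toNontriviallyNormedField X.KInf (WithZero (Multiplicative ℤ))

instance : IsUltrametricDist X.KInf :=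
  letI := X.rankOne
  open scoped Valued in inferInstanceAs (IsUltrametricDist X.KInf)

/-- The algebraic closure of `K_∞`, with the unique extension of the absolute value. -/
def KInfAlg : Type u := AlgebraicClosure X.KInf

instance : NormedField X.KInfAlg := spectralNorm.normedField X.KInf (AlgebraicClosure X.KInf)

instance : NormedAlgebra X.KInf X.KInfAlg :=
  spectralNorm.normedAlgebra X.KInf (AlgebraicClosure X.KInf)

instance : IsAlgClosed X.KInfAlg :=
  AlgebraicClosure.isAlgClosed X.KInf

/-- The field `ℂ_∞`: the completion of the algebraic closure of `K_∞`. -/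
def CInf : Type u := UniformSpace.Completion X.KInfAlg

instance : NormedField X.CInf := inferInstanceAs (NormedField (UniformSpace.Completion X.KInfAlg))
instance : NormedAlgebra X.KInf X.CInf :=
  inferInstanceAs (NormedAlgebra X.KInf (UniformSpace.Completion X.KInfAlg))
instance : CompleteSpace X.CInf :=
  inferInstanceAs (CompleteSpace (UniformSpace.Completion X.KInfAlg))
instance : IsUltrametricDist X.CInf := IsUltrametricDist.of_normedAlgebra X.KInf

/-- The inclusion `K → K_∞ → ℂ_∞`. -/
def embedding : X.K →+* X.CInf :=
  (algebraMap X.KInf X.CInf).comp (algebraMap X.K X.KInf)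

/-- The inclusion `A → K → ℂ_∞`. -/
def inclusion : X.A →+* X.CInf :=
  X.embedding.comp (X.scheme.germToFunctionField X.affinePart).hom

instance : Algebra F X.CInf := (X.inclusion.comp X.structureMap).toAlgebra

/-- The absolute value of `X.CInf` extends the one of `X.KInf`. -/
theorem norm_algebraMap_CInf (x : X.KInf) : ‖algebraMap X.KInf X.CInf x‖ = ‖x‖ :=
  norm_algebraMap' X.CInf x

instance : PerfectField X.CInf := by
  obtain ⟨p, hp⟩ := CharP.exists F
  have hp' : Fact p.Prime := ⟨CharP.char_is_prime F p⟩
  have : CharP X.CInf p := charP_of_injective_algebraMap' F p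
  have : CharP X.KInfAlg p := by
    have h := RingHom.charP_iff (UniformSpace.Completion.coeRingHom : X.KInfAlg →+* X.CInf)
      (RingHom.injective _) p
    exact h.2 this
  have h0 : p ≠ 0 := hp'.out.ne_zero
  have hdist : ∀ x y : X.CInf, dist (x ^ p) (y ^ p) = dist x y ^ p := fun x y => by
    rw [dist_eq_norm, dist_eq_norm, ← sub_pow_char, norm_pow]
  have hclosed : IsClosed (Set.range fun x : X.CInf => x ^ p) := by
    refine (IsUniformInducing.isComplete_range (f := fun x : X.CInf => x ^ p) ?_).isClosed
    refine Metric.isUniformInducing_iff.2 ⟨?_, fun δ hδ => ⟨δ ^ p, pow_pos hδ p, ?_⟩⟩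
    · refine Metric.uniformContinuous_iff.2 fun ε hε =>
        ⟨ε ^ (p : ℝ)⁻¹, Real.rpow_pos_of_pos hε _, fun x y h => ?_⟩
      rw [hdist, ← Real.rpow_inv_natCast_pow hε.le h0]
      exact pow_lt_pow_left₀ h dist_nonneg h0
    · intro x y h
      rw [hdist] at h
      exact lt_of_pow_lt_pow_left₀ p hδ.le h
  have hsurj : Function.Surjective fun x : X.CInf => x ^ p := by
    rw [← Set.range_eq_univ, ← hclosed.closure_eq, ← dense_iff_closure_eq]
    refine UniformSpace.Completion.denseRange_coe.mono ?_
    rintro _ ⟨x, rfl⟩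
    obtain ⟨y, rfl⟩ := IsAlgClosed.exists_pow_nat_eq x (Nat.pos_of_ne_zero h0)
    exact ⟨(UniformSpace.Completion.coeRingHom y : X.CInf),
      (map_pow UniformSpace.Completion.coeRingHom y p).symm⟩
  have : PerfectRing X.CInf p := PerfectRing.ofSurjective X.CInf p hsurj
  exact PerfectRing.toPerfectField X.CInf p

/-- The characteristic morphism `ℓ : A → ℂ_∞`. -/
def charMap : X.A →ₐ[F] X.CInf := { X.inclusion with commutes' := fun _ => rfl }

end PointedCurve

end Curve

end

end AndersonResidue

namespace AndersonResidue

open scoped TensorProduct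
open CategoryTheory

/-! Write `κ' ∘ κ⁻¹ = M_0 + M_1 τ + … + M_s τ ^ s`. Both sides of the comparison see only `M_0`.

On the tangent space this is because `ε² = 0`: a polynomial evaluated at a tangent vector at the
origin retains, in its `ε`-part, only its linear coefficients. Hence `Lie_κ' = M_0 · Lie_κ`
(`Coordinates.lie_eq_mulVec_lie`).

On functions, the residue is `C`-linear, so the term `M_0 F` contributes `M_0` times the residue of
`F`. For `i > 0` the poles of `F⁽ⁱ⁾` lie among the points `τ ^ (n + i) 𝔧` with `n ≥ 0`. If no
positive power of `τ` fixes `𝔧`, then `𝔧` is not one of them, so `F⁽ⁱ⁾` is regular at `𝔧`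
(`regularAt_twistJ_pow`). Its product with a differential of `A`, which is regular as well, has no
residue (`residue_eq_zero_of_regularAt`). Hence the residue vectors are also related by `M_0`
(`Coordinates.residueVec_trans`), and injectivity of `Lie_κ'` concludes.

If instead `τ ^ n 𝔧 = 𝔧` for some `n > 0`, evaluation at `𝔧` gives `ℓ(a) ^ (q ^ n) = ℓ(a)`, and
injectivity of `ℓ` gives `a ^ (q ^ n) = a` for all `a`. Then `da = d(a ^ (q ^ n)) = 0`, so there are
no differentials and both residue maps are zero (`subsingleton_kaehlerDifferential`). Treating this
case separately makes it unnecessary to exhibit an element of `A` transcendental over `F`. -/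

theorem addMonoidHom_ext_tmul {R M N P : Type*} [CommSemiring R] [AddCommMonoid M]
    [AddCommMonoid N] [AddCommMonoid P] [Module R M] [Module R N] {f g : M ⊗[R] N →+ P}
    (h : ∀ x y, f (x ⊗ₜ y) = g (x ⊗ₜ y)) : f = g :=
  AddMonoidHom.ext fun t => by
    induction t using TensorProduct.induction_on with
    | zero => rw [map_zero, map_zero]
    | tmul x y => exact h x y
    | add s t hs ht => rw [map_add, map_add, hs, ht]

/-- Settles the degenerate case in which the module of differentials vanishes. -/
theorem addMonoidHom_eq_of_subsingleton_left {R M N P : Type*} [CommSemiring R] [AddCommMonoid M]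
    [AddCommMonoid N] [AddCommMonoid P] [Module R M] [Module R N] [Subsingleton M]
    (f g : M ⊗[R] N →+ P) : f = g :=
  addMonoidHom_ext_tmul fun x y => by
    rw [Subsingleton.elim x 0, TensorProduct.zero_tmul, map_zero, map_zero]

/-! ### Polynomials at dual numbers -/

section DualNumber

variable {R σ : Type*} [CommRing R]

/-- Setting `ε = 0` moves the point to the origin. The value there is the factor that enters the
product rule in `snd_aeval_inr`. -/
theorem fst_aeval_inr (w : σ → R) (p : MvPolynomial σ R) :
    TrivSqZeroExt.fst (MvPolynomial.aeval (fun l => (TrivSqZeroExt.inr (w l) : DualNumber R)) p) =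
      MvPolynomial.constantCoeff p := by
  induction p using MvPolynomial.induction_on with
  | C a => simp [TrivSqZeroExt.algebraMap_eq_inl]
  | add p q hp hq => rw [map_add, TrivSqZeroExt.fst_add, hp, hq, map_add]
  | mul_X p i _ => simp

/-- Evaluating a polynomial at a tangent vector at the origin only sees its linear part. -/
theorem snd_aeval_inr [Fintype σ] (w : σ → R) (p : MvPolynomial σ R) :
    TrivSqZeroExt.snd (MvPolynomial.aeval (fun l => (TrivSqZeroExt.inr (w l) : DualNumber R)) p) =
      ∑ l, p.coeff (Finsupp.single l 1) * w l := by
  classical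
  induction p using MvPolynomial.induction_on with
  | C a =>
    have h : ∀ l : σ, (0 : σ →₀ ℕ) ≠ Finsupp.single l 1 := fun l h => by
      simpa using DFunLike.congr_fun h l
    simp [TrivSqZeroExt.algebraMap_eq_inl, MvPolynomial.coeff_C, h]
  | add p q hp hq =>
    simp only [map_add, TrivSqZeroExt.snd_add, hp, hq, MvPolynomial.coeff_add, add_mul,
      Finset.sum_add_distrib]
  -- The `ε`-part of `p · X_i` is `p(0) w_i`, because `X_i` takes a value without constant part.
  -- Correspondingly, the coefficient of `X_l` in `p · X_i` is `p(0)` for `l = i` and zero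
  -- otherwise.
  | mul_X p i _ =>
    rw [map_mul, MvPolynomial.aeval_X, TrivSqZeroExt.snd_mul, fst_aeval_inr,
      Finset.sum_eq_single i]
    · simp [MvPolynomial.coeff_mul_X', MvPolynomial.constantCoeff_eq]
    · intro l _ hl
      simp [MvPolynomial.coeff_mul_X', Ne.symm hl]
    · simp

end DualNumber

section Residues

variable {F A C : Type u} [Field F] [Fintype F] [CommRing A] [Algebra F A]
  [NormedField C] [Algebra F C] {ℓ : A →ₐ[F] C}

/-! ### Expansions of regular functions -/

theorem PoleOrderLE.regularAt {x : Point ℓ} {f : Mer ℓ} (hf : PoleOrderLE x 0 f) :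
    RegularAt x f := by
  simpa using hf 1 (by simp)

/-- A `Uniformizer` is an abstract isomorphism of `C`-algebras, so its compatibility with evaluation
needs an argument. After subtracting the constant `h(x)` it remains to treat functions vanishing at
`x`. Their images in the completion are not units, and the non-units of `C⟦π⟧` are the series
without constant term. -/
theorem constantCoeff_taylor {x : Point ℓ} (e : Uniformizer x) (h : Hol ℓ) :
    PowerSeries.constantCoeff (taylor e h) = x.eval h := by
  set m : Hol ℓ := h - algebraMap C (Hol ℓ) (x.eval h) with hm
  have hmx : m ∈ x.ideal := by simp [hm, Point.ideal, RingHom.mem_ker]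
  have h0 : PowerSeries.constantCoeff (taylor e m) = 0 := by
    by_contra hne
    have hu : IsUnit (e (algebraMap (Hol ℓ) (AdicCompletion x.ideal (Hol ℓ)) m)) :=
      PowerSeries.isUnit_iff_constantCoeff.2 (isUnit_iff_ne_zero.2 hne)
    -- Reduction modulo the ideal of `x` would send this unit to zero, forcing the quotient ring to
    -- be trivial although `1` does not vanish at `x`.
    have hu' := ((isUnit_map_iff e _).1 hu).map (AdicCompletion.evalₐ x.ideal 1)
    rw [AlgHom.commutes] at hu'
    have hz : algebraMap (Hol ℓ) (Hol ℓ ⧸ x.ideal ^ 1) m = 0 :=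
      Ideal.Quotient.eq_zero_iff_mem.2 (by rwa [pow_one])
    rw [hz, isUnit_zero_iff] at hu'
    have h1 : (1 : Hol ℓ) ∈ x.ideal ^ 1 := Ideal.Quotient.eq_zero_iff_mem.1 hu'.symm
    rw [pow_one, Point.ideal, RingHom.mem_ker, map_one] at h1
    exact one_ne_zero h1
  have he : h = m + algebraMap C (Hol ℓ) (x.eval h) := by rw [hm]; ring
  calc PowerSeries.constantCoeff (taylor e h)
      = PowerSeries.constantCoeff (taylor e (m + algebraMap C (Hol ℓ) (x.eval h))) := by
        rw [← he]
    _ = x.eval h := by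
        rw [map_add, map_add, h0, AlgHom.commutes, zero_add]
        exact PowerSeries.constantCoeff_C _

theorem coeff_neg_one_ofSeries {x : Point ℓ} (e : Uniformizer x) (s : PowerSeries C) :
    HahnSeries.coeff (ofSeries e s : LaurentSeries C) (-1) = 0 := by
  rw [show (ofSeries e s : LaurentSeries C) = HahnSeries.ofPowerSeries ℤ C s from rfl,
    HahnSeries.ofPowerSeries_apply]
  refine HahnSeries.embDomain_of_notMem_range ?_
  rintro ⟨n, hn⟩
  have hn' : (n : ℤ) = -1 := hn
  omega

/-- Differentials of `A` have no poles at `x`: the derivative of a power series is a power series,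
and the `da` generate `Ω[A⁄F]` over `A`, whose elements also expand as power series. -/
theorem exists_liftKaehlerDifferential_eq {x : Point ℓ} (e : Uniformizer x) (η : Ω[A⁄F]) :
    ∃ s : PowerSeries C, (localDer e).liftKaehlerDifferential η = ofSeries e s := by
  have hη : η ∈ Submodule.span A (Set.range (KaehlerDifferential.D F A)) := by
    rw [KaehlerDifferential.span_range_derivation]; trivial
  induction hη using Submodule.span_induction with
  | mem η h =>
    obtain ⟨a, rfl⟩ := h
    exact ⟨_, Derivation.liftKaehlerDifferential_comp_D _ a⟩
  | zero => exact ⟨0, by rw [map_zero, map_zero]⟩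
  | add η θ _ _ h h' =>
    obtain ⟨s, hs⟩ := h
    obtain ⟨t, ht⟩ := h'
    exact ⟨s + t, by rw [map_add, hs, ht, map_add]⟩
  | smul a η _ h =>
    obtain ⟨s, hs⟩ := h
    refine ⟨taylor e (algebraMap A (Hol ℓ) a) * s, ?_⟩
    rw [map_smul, hs, map_mul, Algebra.smul_def]
    rfl

variable [PerfectField C]

/-- A denominator that does not vanish at `x` has an expansion with nonzero constant term, which is
invertible in `C⟦π⟧`. -/
theorem exists_expand_eq_ofSeries {x : Point ℓ} (e : Uniformizer x) {f : Mer ℓ}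
    (hf : RegularAt x f) : ∃ s : PowerSeries C, expand e f = ofSeries e s := by
  obtain ⟨g, h, hx, E⟩ := hf
  have hc : PowerSeries.constantCoeff (taylor e h) ≠ 0 := by rwa [constantCoeff_taylor]
  refine ⟨taylor e g * (taylor e h)⁻¹, ?_⟩
  rw [expand_eq e (taylor_ne_zero e hx) E,
    div_eq_iff (toLaurent_ne_zero e (taylor_ne_zero e hx))]
  change ofSeries e (taylor e g) = _ * ofSeries e (taylor e h)
  rw [← map_mul, mul_assoc, PowerSeries.inv_mul_cancel _ hc, mul_one]

/-! ### The orbit of a point under `τ` -/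

theorem Point.twist_eval_algebraMap (x : Point ℓ) (a : A) :
    x.twist.eval (algebraMap A (Hol ℓ) a) =
      x.eval (algebraMap A (Hol ℓ) a) ^ Fintype.card F := by
  rw [Point.twist_eval]
  congr 2
  rw [RingEquiv.symm_apply_eq, twistHol_algebraMap]

/-- The functions `a ⊗ 1` are fixed by `τ`, so moving the point only applies the Frobenius of `C` to
their values. This turns a coincidence in the orbit of `𝔧` into an equation satisfied by `A`. -/
theorem Point.iterate_twist_eval_algebraMap (x : Point ℓ) (n : ℕ) (a : A) :
    (Point.twist^[n] x).eval (algebraMap A (Hol ℓ) a) =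
      x.eval (algebraMap A (Hol ℓ) a) ^ Fintype.card F ^ n := by
  induction n with
  | zero => simp
  | succ n ih =>
    rw [Function.iterate_succ_apply', Point.twist_eval_algebraMap, ih, ← pow_mul, ← pow_succ]

theorem RegularAt.iterate_twist {x : Point ℓ} {f : Mer ℓ} (hf : RegularAt x f) (i : ℕ) :
    RegularAt (Point.twist^[i] x) ((twistMer ℓ)^[i] f) := by
  induction i with
  | zero => exact hf
  | succ i ih =>
    rw [Function.iterate_succ_apply', Function.iterate_succ_apply']
    exact ih.twist

/-! ### The point `𝔧` -/

section CharPoint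

variable [IsUltrametricDist C] [CompleteSpace C]

variable (ℓ) in
theorem charPoint_eval_algebraMap (a : A) :
    (charPoint ℓ).eval (algebraMap A (Hol ℓ) a) = ℓ a := by
  refine (UniformSpace.Completion.extensionHom_coe _ (continuous_mulMap ℓ) (tens ℓ 1 a)).trans ?_
  refine (Algebra.TensorProduct.lift_tmul _ _ _ _ _).trans ?_
  simp

/-! ### Vanishing and `C`-linearity of the residue. -/

theorem residue_tmul {x : Point ℓ} (e : Uniformizer x) (η : Ω[A⁄F]) (f : merJ ℓ) :
    residue e (η ⊗ₜ f) =
      HahnSeries.coeff ((localDer e).liftKaehlerDifferential η * expand e f : LaurentSeries C)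
        (-1) := rfl

theorem residue_eq_zero_of_regularAt {x : Point ℓ} (e : Uniformizer x) (η : Ω[A⁄F])
    {f : merJ ℓ} (hf : RegularAt x (f : Mer ℓ)) : residue e (η ⊗ₜ f) = 0 := by
  obtain ⟨s, hs⟩ := exists_expand_eq_ofSeries e hf
  obtain ⟨t, ht⟩ := exists_liftKaehlerDifferential_eq e η
  rw [residue_tmul, hs, ht]
  exact (congrArg (fun z : LaurentSeries C => z.coeff (-1)) (map_mul (ofSeries e) t s).symm).trans
    (coeff_neg_one_ofSeries e _)

/-- `expandJ` is linear over `A` only, while the entries of the matrices `M_i` are scalars in `C`.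
If `f = g / h`, then `c f = (c g) / h`, and the Taylor expansion respects constants. -/
theorem expand_smul {x : Point ℓ} (e : Uniformizer x) (c : C) (f : merJ ℓ) :
    expand e ((c • f : merJ ℓ) : Mer ℓ) =
      ofSeries e (PowerSeries.C c) * expand e (f : Mer ℓ) := by
  obtain ⟨g, h, h0, E⟩ := exists_fraction e f.2
  rw [expand_eq e h0 E, expand_eq e (g := algebraMap C (Hol ℓ) c * g) h0, mul_div_assoc', map_mul]
  · congr 2
    exact congrArg (ofSeries e) ((taylor e).commutes c)
  · rw [map_mul, ← E, show ((c • f : merJ ℓ) : Mer ℓ) = c • (f : Mer ℓ) from rfl,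
      Algebra.smul_def, IsScalarTower.algebraMap_apply C (Hol ℓ) (Mer ℓ)]
    ring

theorem residue_tmul_smul {x : Point ℓ} (e : Uniformizer x) (η : Ω[A⁄F]) (c : C) (f : merJ ℓ) :
    residue e (η ⊗ₜ (c • f)) = c * residue e (η ⊗ₜ f) := by
  rw [residue_tmul, residue_tmul, expand_smul, mul_left_comm]
  have h : (ofSeries e (PowerSeries.C c) : LaurentSeries C) = HahnSeries.C c :=
    HahnSeries.ofPowerSeries_C c
  refine (congrArg (fun z : LaurentSeries C => (z * _).coeff (-1)) h).trans ?_
  exact congrArg (fun z : LaurentSeries C => z.coeff (-1)) HahnSeries.C_mul_eq_smul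

/-! ### Twists at `𝔧`, and the case of a finite orbit. -/

theorem coe_twistJ_pow (i : ℕ) (f : merJ ℓ) :
    (((twistJ ℓ ^ i) f : merJ ℓ) : Mer ℓ) = (twistMer ℓ)^[i] f := by
  induction i with
  | zero => rfl
  | succ i ih =>
    rw [pow_succ', Module.End.mul_apply, Function.iterate_succ_apply', ← ih]
    rfl

/-- If the `τ`-orbit of `𝔧` is infinite, the proper twists of the elements of `𝒥(𝔛)` are regular
at `𝔧`. -/
theorem regularAt_twistJ_pow (H : ∀ n : ℕ, 0 < n → Point.twist^[n] (charPoint ℓ) ≠ charPoint ℓ)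
    {i : ℕ} (hi : 0 < i) (f : merJ ℓ) :
    RegularAt (charPoint ℓ) (((twistJ ℓ ^ i) f : merJ ℓ) : Mer ℓ) := by
  have hy : Point.twist^[i] (Point.untwist^[i] (charPoint ℓ)) = charPoint ℓ :=
    Function.LeftInverse.iterate (g := Point.twist (ℓ := ℓ)) Point.twist_untwist i _
  -- An equality `τ⁻ⁱ 𝔧 = τⁿ 𝔧` with `n ≥ 0` would give `τ ^ (i + n) 𝔧 = 𝔧` with `i + n > 0`.
  have hJ : Point.untwist^[i] (charPoint ℓ) ∉ suppJ ℓ := by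
    rintro ⟨n, hn⟩
    refine H (i + n) (by omega) ?_
    rw [Function.iterate_add_apply]
    exact (congrArg _ hn).trans hy
  obtain ⟨n, h0, hn⟩ := f.2
  -- Off the support of `J` the pole order is bounded by zero, so `f` is regular at `τ⁻ⁱ 𝔧`.
  -- Applying `τ ^ i` to both the function and the point carries this to `𝔧`.
  have hp := hn (Point.untwist^[i] (charPoint ℓ))
  rw [h0 _ hJ] at hp
  have hr := hp.regularAt.iterate_twist i
  rwa [hy, ← coe_twistJ_pow] at hr

/-- If the `τ`-orbit of `𝔧` is finite and `ℓ` is injective, then `A` has no differentials. -/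
theorem subsingleton_kaehlerDifferential (hℓ : Function.Injective ℓ) {n : ℕ} (hn : 0 < n)
    (h : Point.twist^[n] (charPoint ℓ) = charPoint ℓ) : Subsingleton Ω[A⁄F] := by
  have hpow : ∀ a : A, a ^ Fintype.card F ^ n = a := fun a => hℓ <| by
    rw [map_pow, ← charPoint_eval_algebraMap, ← Point.iterate_twist_eval_algebraMap, h]
  have hcard : ((Fintype.card F ^ n : ℕ) : A) = 0 := by
    rw [Nat.cast_pow, ← map_natCast (algebraMap F A) (Fintype.card F), FiniteField.cast_card_eq_zero,
      map_zero, zero_pow hn.ne']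
  -- The Leibniz rule for `a = a ^ (q ^ n)` produces the factor `q ^ n`, which is zero in `A`
  -- because `n > 0`.
  have hD : ∀ a : A, KaehlerDifferential.D F A a = 0 := fun a => by
    rw [← hpow a, Derivation.leibniz_pow, ← Nat.cast_smul_eq_nsmul A, hcard, zero_smul]
  refine (Submodule.subsingleton_iff A).1 (subsingleton_of_bot_eq_top ?_)
  rw [← KaehlerDifferential.span_range_derivation, eq_comm, Submodule.span_eq_bot]
  rintro _ ⟨a, rfl⟩
  exact hD a

end CharPoint

/-! ### Changes of coordinates -/

section Coord

variable {E : CommAlgCat.{u} C ⥤ ModuleCat.{u} A} {d : ℕ}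

/-- This is Yoneda's lemma: the point `v` is the image of the generic point `(X_1, …, X_d)` under
the homomorphism sending each `X_l` to the `l`-th coordinate of `v`, and `κ'` is natural. -/
theorem Coordinates.equiv_eq_aeval_transPoly (κ κ' : Coordinates F E d) (R : CommAlgCat.{u} C)
    (v : E.obj R) (k : Fin d) :
    (κ'.equiv R v : Fin d → R) k =
      MvPolynomial.aeval (κ.equiv R v : Fin d → R) (κ.transPoly κ' k) := by
  set φ : polyAlg C d ⟶ R :=
    CommAlgCat.ofHom (MvPolynomial.aeval (κ.equiv R v : Fin d → R)) with hφ
  set u : E.obj (polyAlg C d) := (κ.equiv (polyAlg C d)).symm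
    (fun l => MvPolynomial.X l : Fin d → MvPolynomial (Fin d) C) with hu
  have hv : (E.map φ).hom u = v := by
    refine (κ.equiv R).injective (funext fun l => ?_)
    refine (κ.equiv_map φ u l).trans ?_
    refine (congrArg (fun g : Fin d → MvPolynomial (Fin d) C => φ.hom (g l))
      ((κ.equiv (polyAlg C d)).apply_symm_apply _)).trans ?_
    exact MvPolynomial.aeval_X _ l
  have h := κ'.equiv_map φ u k
  rw [hv] at h
  exact h

theorem Coordinates.lie_eq_mulVec_lie (κ κ' : Coordinates F E d) (v : Lie E) :
    κ'.lie v = (κ.transMatrix κ' 0).mulVec (κ.lie v) := by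
  funext k
  -- A tangent vector reduces to the origin at `ε = 0`, so its coordinates are pure multiples of
  -- `ε`. The inverse of `Coordinates.lie` already has this form.
  have h1 : (κ.equiv (dual C) (v : E.obj (dual C)) : Fin d → DualNumber C) =
      fun l => TrivSqZeroExt.inr (κ.lie v l) := by
    have h := congrArg Subtype.val (κ.lie.symm_apply_apply v)
    refine (congrArg (κ.equiv (dual C)) h.symm).trans ?_
    exact (κ.equiv (dual C)).apply_symm_apply _
  have h2 := congrArg TrivSqZeroExt.snd
    (κ.equiv_eq_aeval_transPoly κ' (dual C) (v : E.obj (dual C)) k)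
  refine h2.trans ?_
  refine (congrArg (fun w : Fin d → DualNumber C => TrivSqZeroExt.snd
    (MvPolynomial.aeval w (κ.transPoly κ' k))) h1).trans ?_
  rw [snd_aeval_inr]
  -- The linear coefficients are the entries of `M_0` because `q ^ 0 = 1`.
  simp [Matrix.mulVec, dotProduct, Coordinates.transMatrix]

/-! ### Residues under a change of coordinates. -/

variable [IsUltrametricDist C] [CompleteSpace C]

theorem residueVec_tmul {x : Point ℓ} (e : Uniformizer x) (η : Ω[A⁄F]) (G : Fin d → merJ ℓ)
    (k : Fin d) : residueVec e d (η ⊗ₜ G) k = residue e (η ⊗ₜ G k) := rfl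

theorem Coordinates.residueVec_trans
    (H : ∀ n : ℕ, 0 < n → Point.twist^[n] (charPoint ℓ) ≠ charPoint ℓ)
    (κ κ' : Coordinates F E d) (e : Uniformizer (charPoint ℓ)) (η : Ω[A⁄F])
    (G : Fin d → merJ ℓ) :
    residueVec e d (η ⊗ₜ κ.trans ℓ κ' G) =
      (κ.transMatrix κ' 0).mulVec (residueVec e d (η ⊗ₜ G)) := by
  funext k
  rw [residueVec_tmul]
  change residue e (η ⊗ₜ ∑ i ∈ Finset.range (κ.transDegree κ' + 1), ∑ l,
    κ.transMatrix κ' i k l • (twistJ ℓ ^ i) (G l)) = _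
  -- The term `i = 0` is split off and yields `M_0` times the residue vector. In the remaining sum
  -- the twist exponent is `i + 1 > 0`, so every term has zero residue.
  rw [Finset.sum_range_succ', TensorProduct.tmul_add, map_add, TensorProduct.tmul_sum, map_sum,
    Finset.sum_eq_zero, zero_add, TensorProduct.tmul_sum, map_sum]
  · simp only [residue_tmul_smul]
    rfl
  · intro i _
    rw [TensorProduct.tmul_sum, map_sum]
    refine Finset.sum_eq_zero fun l _ => ?_
    rw [residue_tmul_smul,
      residue_eq_zero_of_regularAt e η (regularAt_twistJ_pow H i.succ_pos (G l)), mul_zero]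

/-- Membership in the inverse limit, read in `𝒥(𝔛) ^ d`: the component at `κ'` is the transition of
the one at `κ`, and `m_κ'` undoes the final map of that transition. -/
theorem Coordinates.m_proj (κ κ' : Coordinates F E d) (s : valuedFunctions ℓ E d) :
    κ'.m ℓ (κ'.proj ℓ s) = κ.trans ℓ κ' (κ.m ℓ (κ.proj ℓ s)) := by
  change κ'.m ℓ (s.1 κ') = κ.trans ℓ κ' (κ.m ℓ (s.1 κ))
  rw [← s.2 κ κ']
  exact κ'.m_lower _

theorem Coordinates.res_eq_res (hℓ : Function.Injective ℓ) (κ κ' : Coordinates F E d)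
    (e : Uniformizer (charPoint ℓ)) : κ.res e = κ'.res e := by
  by_cases H : ∀ n : ℕ, 0 < n → Point.twist^[n] (charPoint ℓ) ≠ charPoint ℓ
  -- Both values are compared in the coordinates `κ'`; each becomes `M_0` applied to the residue
  -- vector computed with `κ`.
  · refine addMonoidHom_ext_tmul fun η s => κ'.lie.injective ?_
    rw [κ.lie_eq_mulVec_lie κ', κ.lie_res, κ'.lie_res, LinearMap.lTensor_tmul,
      LinearMap.lTensor_tmul, LinearMap.comp_apply, LinearMap.comp_apply, κ.m_proj κ',
      κ.residueVec_trans H]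
  · push Not at H
    obtain ⟨n, hn, h⟩ := H
    have := subsingleton_kaehlerDifferential hℓ hn h
    exact addMonoidHom_eq_of_subsingleton_left _ _

end Coord

end Residues

/-- The curve is integral, so a section is determined by its germ at the generic point, and
homomorphisms out of the function field are injective. -/
theorem PointedCurve.charMap_injective {F : Type u} [Field F] [Fintype F] (X : PointedCurve F) :
    Function.Injective X.charMap :=
  X.embedding.injective.comp
    (AlgebraicGeometry.Scheme.germToFunctionField_injective X.scheme X.affinePart)

end AndersonResidue

/-- The residue maps defined by means of any two choices of coordinates `κ` and `κ'` on an Anderson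
`A`-module `E` over `ℂ_∞` are equal. -/
theorem proposition4p1 {F : Type u} [Field F] [Fintype F] (X : AndersonResidue.PointedCurve F)
    (d : ℕ) (E : AndersonResidue.AndersonModule X.charMap d)
    (e : AndersonResidue.Uniformizer (AndersonResidue.charPoint X.charMap))
    (κ κ' : AndersonResidue.Coordinates F E.functor d) :
    κ.res e = κ'.res e :=
  κ.res_eq_res X.charMap_injective κ' e
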